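/- **Setting.** For a prime power $q$ let $\mathrm{RS}[q,k]_q=\{(f(\alpha_1),\dots,f(\alpha_q)) : f\in\mathbb F_q[x],\ \deg f<k\}$ be the Reed–Solomon code whose evaluation points $\alpha_1,\dots,\alpha_q$ are all the elements of $\mathbb F_q$. For $\tau\in(0,1-\frac1q)$ put $$\tau^\perp=\frac1q\Bigl(\sqrt{(q-1)(1-\tau)}-\sqrt{\tau}\Bigr)^2,\qquad \tau'=\tau^\perp\bigl(1+(\tau^\perp q)^{-1/3}\bigr),$$ and let $u:\mathbb F_q\to\mathbb C$ be $u(0)=\sqrt{1-\tau}$ and $u(a)=\sqrt{\tau/(q-1)}$ for $a\ne 0$. * $\mathrm{QDP}(\mathcal C,\tau)$, for a linear code $\mathcal C\subseteq\mathbb F_q^n$: $\mathbf c\in\mathcal C$ is uniformly random; given the state $|\psi_{\mathbf c}\rangle=\sum_{\mathbf e\in\mathbb F_q^n}u^{\otimes n}(\mathbf e)\,|\mathbf c+\mathbf e\rangle$, find $\mathbf c$. * $\mathrm{IBDD}(\mathcal C,t)$: given a uniformly random $\mathbf y_0\in\mathbb F_q^n$, find $\mathbf c\in\mathcal C$ with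 Hamming distance $d_H(\mathbf c,\mathbf y_0)\le t$. Success probabilities are over the random instance and the measurement. A quantum algorithm is a family of quantum circuits on $q$-ary qudits, one for each parameter tuple: ancillas start in $|0\rangle$, gates are arbitrary unitaries on at most three qudits, and the output is obtained by a final measurement. The size of a circuit (its running time) is the number of wires plus $q^{2r}$ for each gate on $r$ qudits, and the algorithm is efficient if its size is at most a fixed polynomial in $q$. A function $\varepsilon$ is $\mathrm{negl}(q)$ if $q^{c}\varepsilon\to0$ as $q\to\infty$ for every $c\in\mathbb N$. **Theorem.** Consider any family of parameters $(q,k,\tau,P_{\mathrm{Dec}})$ with $q$ a prime power, $1\le k\le q-1$, $\tau\in(0,1-\frac1q)$ and $P_{\mathrm{Dec}}>0$, where $k,\tau,P_{\mathrm{Dec}}$ may vary with $q$. Suppose that there is an efficient quantum algorithm that solves $\mathrm{QDP}(\mathrm{RS}[q,q-k]_q,\tau)$ with success probability at least $P_{\mathrm{Dec}}$. Then there is a quantum algorithm for $\mathrm{IBDD}(\mathrm{RS}[q,k]_q,\tau'q)$ that runs in time $\mathrm{poly}(q)/P_{\mathrm{Dec}}$, and hence is efficient if $P_{\mathrm{Dec}}\ge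 1/\mathrm{poly}(q)$, and that succeeds with probability at least $P_{\mathrm{Dec}}-\varepsilon$, where $$0\le\varepsilon\le 3\exp\Bigl(-\tfrac16(\tau^\perp q)^{1/3}\Bigr);$$ in particular $\varepsilon=\mathrm{negl}(q)$ whenever $\tau^\perp q/(\log q)^3\to\infty$ as $q\to\infty$. Moreover, $\tau'=\tau^\perp(1+o(1))$ whenever $\tau^\perp q\to\infty$. -/

import Mathlib

open Filter Topology

namespace QuditRS

noncomputable section

/-! ### Linear codes -/

/-- The Reed-Solomon code with evaluation points `α 0, …, α (n-1)`: all words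
`(f (α 0), …, f (α (n-1)))` with `f` a polynomial of degree `< k`. -/
def reedSolomon {F : Type*} [Field F] {n : ℕ} (α : Fin n → F) (k : ℕ) :
    Submodule F (Fin n → F) :=
  (Polynomial.degreeLT F k).map (LinearMap.pi fun i => Polynomial.leval (α i))

/-! ### Quantum states and circuits on `F`-ary qudits -/

/-- Vectors of the Hilbert space of `m` qudits whose basis states are labelled by `F`:
`x : Fin m → F` labels the computational basis state `|x⟩`, and `ψ x` is its amplitude. -/
abbrev State (F : Type*) (m : ℕ) : Type _ := (Fin m → F) → ℂ

/-- The computational basis state `|x⟩`. -/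
def ket {F : Type*} [DecidableEq F] {m : ℕ} (x : Fin m → F) : State F m := Pi.single x 1

/-- A gate on a register of `m` qudits: an arbitrary unitary acting on at most three qudits. -/
structure Gate (F : Type*) [Fintype F] [DecidableEq F] (m : ℕ) where
  arity : ℕ
  arity_le : arity ≤ 3
  wires : Fin arity ↪ Fin m
  U : Matrix.unitaryGroup (Fin arity → F) ℂ

/-- The action of a gate on the whole register (the gate tensored with the identity on the other
wires). `Function.extend wires z x` is the label `x` with the entries on the gate's wires
replaced by `z`. -/
def Gate.apply {F : Type*} [Fintype F] [DecidableEq F] {m : ℕ} (g : Gate F m)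
    (ψ : State F m) : State F m :=
  fun x => ∑ z : Fin g.arity → F,
    (g.U : Matrix (Fin g.arity → F) (Fin g.arity → F) ℂ) (x ∘ g.wires) z *
      ψ (Function.extend g.wires z x)

/-- The number of elementary steps charged for a gate acting on `r` qudits of dimension `q = |F|`:
the number `q ^ (2 * r)` of entries of its matrix (such a unitary is a product of fewer than
`q ^ (2 * r)` two-level unitaries). -/
def Gate.cost {F : Type*} [Fintype F] [DecidableEq F] {m : ℕ} (g : Gate F m) : ℕ :=
  Fintype.card F ^ (2 * g.arity)

/-- A quantum circuit with an `n`-qudit input register (wires `0, …, n-1`) and `anc` ancilla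
qudits (the remaining wires), the latter initialised to `|0⟩`. After all gates have been applied,
in the order of the list, the first `n` wires are measured in the computational basis, which gives
the output. -/
structure Circuit (F : Type*) [Fintype F] [DecidableEq F] (n : ℕ) where
  anc : ℕ
  gates : List (Gate F (n + anc))

/-- The size of a circuit: number of wires plus total cost of the gates. -/
def Circuit.size {F : Type*} [Fintype F] [DecidableEq F] {n : ℕ} (A : Circuit F n) : ℕ :=
  n + A.anc + (A.gates.map Gate.cost).sum

/-- The state `ψ ⊗ |0⟩^{⊗ a}`. -/
def withAncilla {F : Type*} [Zero F] [DecidableEq F] {n : ℕ} (a : ℕ) (ψ : State F n) :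
    State F (n + a) :=
  fun x => if ∀ j : Fin a, x (Fin.natAdd n j) = 0 then ψ (fun i => x (Fin.castAdd a i)) else 0

/-- The state of the whole register after the circuit has been run on input `ψ`. -/
def Circuit.run {F : Type*} [Fintype F] [DecidableEq F] [Zero F] {n : ℕ} (A : Circuit F n)
    (ψ : State F n) : State F (n + A.anc) :=
  A.gates.foldl (fun φ g => g.apply φ) (withAncilla A.anc ψ)

/-- The probability that the circuit, run on input `ψ`, outputs `y`. -/
def Circuit.outputProb {F : Type*} [Fintype F] [DecidableEq F] [Zero F] {n : ℕ}
    (A : Circuit F n) (ψ : State F n) (y : Fin n → F) : ℝ :=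
  ∑ w : Fin A.anc → F, ‖A.run ψ (Fin.append y w)‖ ^ 2

/-! ### The two decoding problems -/

/-- The noisy codeword state `|ψ_c⟩ = ∑ e, f e |c + e⟩`. -/
def noisyState {F : Type*} [Field F] [Fintype F] [DecidableEq F] {n : ℕ}
    (f : (Fin n → F) → ℂ) (c : Fin n → F) : State F n :=
  ∑ e : Fin n → F, f e • ket (c + e)

open Classical in
/-- The success probability of a circuit for the quantum decoding problem `QDP(C, f)`: the
codeword `c` is uniform in `C`, the input is `|ψ_c⟩`, and the output has to be `c`. -/
def qdpSuccess {F : Type*} [Field F] [Fintype F] [DecidableEq F] {n : ℕ}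
    (C : Submodule F (Fin n → F)) (f : (Fin n → F) → ℂ) (A : Circuit F n) : ℝ :=
  (∑ c : C, A.outputProb (noisyState f c) c) / (Nat.card C : ℝ)

open Classical in
/-- The success probability of a circuit for inhomogeneous bounded distance decoding
`IBDD(C, t)`: the input `y₀` is uniform in `F ^ n`, and the output has to be a codeword of `C` at
Hamming distance at most `t` from `y₀`. -/
def ibddSuccess {F : Type*} [Field F] [Fintype F] [DecidableEq F] {n : ℕ}
    (C : Submodule F (Fin n → F)) (t : ℝ) (A : Circuit F n) : ℝ :=
  (∑ y₀ : Fin n → F,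
    ∑ c : Fin n → F with c ∈ C ∧ (hammingDist c y₀ : ℝ) ≤ t, A.outputProb (ket y₀) c) /
      (Nat.card (Fin n → F) : ℝ)

/-! ### The Bernoulli-type amplitude and the dual parameter -/

/-- The one-symbol amplitude `u`: `√(1 - τ)` at `0` and `√(τ / (q - 1))` elsewhere. -/
def bernoulliAmp (F : Type*) [Field F] [Fintype F] [DecidableEq F] (τ : ℝ) (a : F) : ℂ :=
  if a = 0 then (√(1 - τ) : ℝ) else (√(τ / ((Fintype.card F : ℝ) - 1)) : ℝ)

/-- The product amplitude `u ^ {⊗ n}`. -/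
def prodAmp {F : Type*} {n : ℕ} (u : F → ℂ) (e : Fin n → F) : ℂ := ∏ i, u (e i)

/-- `τ^⊥` for alphabet size `q`. -/
def tauPerp (q : ℕ) (τ : ℝ) : ℝ :=
  1 / (q : ℝ) * (√(((q : ℝ) - 1) * (1 - τ)) - √τ) ^ 2

/-- `τ' = τ^⊥ (1 + (τ^⊥ q)^{-1/3})`. -/
def tauPrime (q : ℕ) (τ : ℝ) : ℝ :=
  tauPerp q τ * (1 + (tauPerp q τ * q) ^ (-(1 / 3 : ℝ)))

/-! ### Efficiency -/

/-- The sizes `s i` are bounded by a polynomial in the parameters `q i`. -/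
def PolyBounded {ι : Type*} (q s : ι → ℕ) : Prop :=
  ∃ p : Polynomial ℕ, ∀ i, s i ≤ p.eval (q i)

/-- `P i ≥ 1 / poly(q i)`. -/
def InversePolyBounded {ι : Type*} (q : ι → ℕ) (P : ι → ℝ) : Prop :=
  ∃ p : Polynomial ℕ, ∀ i, 1 ≤ P i * ((p.eval (q i) : ℕ) : ℝ)

/-- `ε = negl(q)`: `ε` is smaller than every inverse power of `q` as `q → ∞`. -/
def Negligible {ι : Type*} (q : ι → ℕ) (ε : ι → ℝ) : Prop :=
  Asymptotics.SuperpolynomialDecay (comap q atTop) (fun i => (q i : ℝ)) ε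

end

end QuditRS

open QuditRS

namespace QuditRS

noncomputable section

open Matrix

set_option linter.unusedSectionVars false

/-! ### Matrices on registers -/

/-! This is Regev's duality reduction, made quantitative. Fix a primitive additive character `χ`,
and let `E` be the encoding matrix of the code of dimension `q - k`. For an input `y`, consider the
superposition over messages `m` of `χ (m ⬝ᵥ (y ᵥ* E))` times the noisy codeword of `E *ᵥ m`, with no
message register (`phasedState`). Summing over `m` makes its Fourier transform live on words `x`
with `(y - x) ᵥ* E = 0` (`norm_sq_dft_phasedState`). With full support this says that `y - x` lies
in the Reed-Solomon code of dimension `k` (`mem_reedSolomon_of_orthogonal`). Averaged over `y`, the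
word `x` has independent symbols, each nonzero with probability `τ^⊥` (`norm_sq_dft_bernoulliAmp`),
so by `chernoff` its weight rarely exceeds `τ' q`. Measuring `x` and outputting `y - x` would
therefore solve the bounded distance problem.

This ideal state cannot be prepared directly, because the message register must first be erased. The
QDP decoder, applied coherently, finds the message, which is then subtracted from that register. The
branch where the register becomes zero has squared norm `p = decodeProb`, which is at least the QDP
success probability. It is the same for every `y`, since `y` enters only through phases. A rotation
qudit lowers the amplitude from `√p` to the sine of an exact angle, so `amplification` produces the
normalised branch `decodedState` without error, in about `1/P` rounds. Undoing the decoder and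
applying the Fourier transform completes the circuit (`exists_decodingCircuit`).

Real and ideal states are compared on the direct sum over all `y`: character orthogonality gives
average overlap exactly `√p` (`inner_phasedState_decodedState`). By Cauchy-Schwarz, the real state
is good with average probability at least `p - 2√η`, where `η` bounds the ideal bad mass
(`sub_two_mul_sqrt_le`). Overlap `√p`, rather than `p`, is what keeps the success probability near
`P` instead of `P ^ 2`. `decodeProb_sub_le` and `exists_ibdd_circuit` combine these facts. -/

theorem extend_comp_embedding {F : Type*} {V W : Type} (ι : V ↪ W) (z : V → F) (x : W → F) :
    Function.extend ι z x ∘ ι = z := Function.extend_comp ι.injective z x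

theorem eq_extend_iff {F : Type*} {V W : Type} (ι : V ↪ W) (z : V → F) (x y : W → F) :
    y = Function.extend ι z x ↔ y ∘ ι = z ∧ ∀ w, w ∉ Set.range ι → x w = y w := by
  constructor
  · rintro rfl
    exact ⟨extend_comp_embedding ι z x, fun w hw => (Function.extend_apply' z x w hw).symm⟩
  · rintro ⟨rfl, h⟩
    funext w
    by_cases hw : w ∈ Set.range ι
    · obtain ⟨v, rfl⟩ := hw
      rw [ι.injective.extend_apply]; rfl
    · rw [Function.extend_apply' _ _ _ hw, h w hw]

section Register

variable {F : Type*} [Fintype F] [DecidableEq F]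
variable {V W : Type} [Fintype V] [DecidableEq V] [Fintype W] [DecidableEq W]

open Classical in
/-- The matrix `M` acting on the wires `ι`, tensored with the identity on the other wires. -/
def lift (ι : V ↪ W) (M : Matrix (V → F) (V → F) ℂ) : Matrix (W → F) (W → F) ℂ :=
  fun x y => if ∀ w, w ∉ Set.range ι → x w = y w then M (x ∘ ι) (y ∘ ι) else 0

theorem lift_mulVec (ι : V ↪ W) (M : Matrix (V → F) (V → F) ℂ) (ψ : (W → F) → ℂ)
    (x : W → F) :
    (lift ι M *ᵥ ψ) x = ∑ z, M (x ∘ ι) z * ψ (Function.extend ι z x) := by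
  symm
  refine Fintype.sum_of_injective (fun z => Function.extend ι z x) ?_ _ _ ?_ ?_
  · intro z z' h
    simpa [extend_comp_embedding] using congrArg (fun f => f ∘ ι) h
  · intro y hy
    have : lift ι M x y = 0 := if_neg fun h => hy ⟨y ∘ ι, ((eq_extend_iff ι _ x y).2 ⟨rfl, h⟩).symm⟩
    change lift ι M x y * ψ y = 0
    rw [this, zero_mul]
  · intro z
    have : lift ι M x (Function.extend ι z x) = M (x ∘ ι) (Function.extend ι z x ∘ ι) :=
      if_pos fun w hw => (Function.extend_apply' z x w hw).symm
    change _ = lift ι M x _ * _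
    rw [this, extend_comp_embedding]

theorem ext_mulVec {m : Type*} [Fintype m] [DecidableEq m] {M N : Matrix m m ℂ}
    (h : ∀ v, M *ᵥ v = N *ᵥ v) : M = N := by
  ext i j
  have := congrFun (h (Pi.single j 1)) i
  simpa using this

theorem lift_mul (ι : V ↪ W) (M N : Matrix (V → F) (V → F) ℂ) :
    lift ι (M * N) = lift ι M * lift ι N := by
  refine ext_mulVec fun ψ => ?_
  rw [← mulVec_mulVec]
  funext x
  simp only [lift_mulVec, extend_comp_embedding, mul_apply, Finset.sum_mul, Finset.mul_sum]
  rw [Finset.sum_comm]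
  refine Finset.sum_congr rfl fun z _ => Finset.sum_congr rfl fun z' _ => ?_
  rw [mul_assoc]
  congr 3
  refine (eq_extend_iff ι z' _ _).2 ⟨extend_comp_embedding .., fun w hw => ?_⟩
  rw [Function.extend_apply' _ _ _ hw, Function.extend_apply' _ _ _ hw]

theorem lift_one (ι : V ↪ W) :
    lift ι (1 : Matrix (V → F) (V → F) ℂ) = 1 := by
  refine ext_mulVec fun ψ => ?_
  funext x
  rw [lift_mulVec, one_mulVec, Finset.sum_eq_single (x ∘ ι)]
  · rw [one_apply_eq, one_mul, ← (eq_extend_iff ι (x ∘ ι) x x).2 ⟨rfl, fun _ _ => rfl⟩]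
  · intro z _ hz
    rw [one_apply_ne' hz, zero_mul]
  · simp

theorem lift_conjTranspose (ι : V ↪ W) (M : Matrix (V → F) (V → F) ℂ) :
    (lift ι M)ᴴ = lift ι Mᴴ := by
  ext x y
  simp only [conjTranspose_apply, lift, apply_ite star, star_zero]
  simp only [eq_comm]

theorem lift_mem_unitary (ι : V ↪ W) {M : Matrix (V → F) (V → F) ℂ}
    (hM : M ∈ unitaryGroup (V → F) ℂ) : lift ι M ∈ unitaryGroup (W → F) ℂ := by
  rw [mem_unitaryGroup_iff, star_eq_conjTranspose] at hM ⊢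
  rw [lift_conjTranspose, ← lift_mul, hM, lift_one]

/-- Composing embeddings of wires keeps a gate a gate of the same arity. This lets circuits be built
on structured wire types and transported to `Fin` only at the end, at no cost. -/
theorem lift_lift {V' : Type} [Fintype V'] [DecidableEq V'] (κ : V' ↪ V) (ι : V ↪ W) (M : Matrix (V' → F) (V' → F) ℂ) :
    lift ι (lift κ M) = lift (κ.trans ι) M := by
  ext x y
  simp only [lift]
  by_cases h : ∀ w, w ∉ Set.range (κ.trans ι) → x w = y w
  · rw [if_pos h, if_pos, if_pos]
    · rfl
    · intro v hv
      refine h _ ?_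
      rintro ⟨u, hu⟩
      exact hv ⟨u, ι.injective hu⟩
    · rintro w hw
      refine h _ ?_
      rintro ⟨u, rfl⟩
      exact hw ⟨κ u, rfl⟩
  · rw [if_neg h]
    split_ifs with h1 h2
    · exfalso
      apply h
      intro w hw
      by_cases hw' : w ∈ Set.range ι
      · obtain ⟨v, rfl⟩ := hw'
        refine h2 v ?_
        rintro ⟨u, rfl⟩
        exact hw ⟨u, rfl⟩
      · exact h1 w hw'
    · rfl
    · rfl

/-- The matrix of a classical map of basis labels. -/
def funMat (f : (W → F) → W → F) : Matrix (W → F) (W → F) ℂ :=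
  fun x y => if x = f y then 1 else 0

theorem funMat_mulVec {f g : (W → F) → W → F} (h : ∀ x, f (g x) = x) (h' : ∀ x, g (f x) = x)
    (ψ : (W → F) → ℂ) (x : W → F) : (funMat f *ᵥ ψ) x = ψ (g x) := by
  simp only [mulVec, dotProduct, funMat]
  rw [Finset.sum_eq_single (g x)]
  · simp [h]
  · intro y _ hy
    rw [if_neg, zero_mul]
    rintro rfl
    exact hy (h' y).symm
  · simp

theorem funMat_comp (f g : (W → F) → W → F) : funMat (f ∘ g) = funMat f * funMat g := by
  ext x y
  simp [funMat, mul_apply]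

theorem funMat_id : funMat (id : (W → F) → W → F) = 1 := by
  ext x y
  simp [funMat, one_apply]

theorem funMat_conjTranspose {f g : (W → F) → W → F} (h : ∀ x, f (g x) = x)
    (h' : ∀ x, g (f x) = x) : (funMat f)ᴴ = funMat g := by
  ext x y
  have : y = f x ↔ x = g y := ⟨fun e => by rw [e, h'], fun e => by rw [e, h]⟩
  simp [funMat, conjTranspose_apply, apply_ite star, this]

theorem funMat_mem_unitary {f g : (W → F) → W → F} (h : ∀ x, f (g x) = x)
    (h' : ∀ x, g (f x) = x) : funMat f ∈ unitaryGroup (W → F) ℂ := by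
  rw [mem_unitaryGroup_iff, star_eq_conjTranspose, funMat_conjTranspose h h', ← funMat_comp,
    ← funMat_id]
  congr 1
  funext x
  exact h x

theorem lift_funMat (ι : V ↪ W) (f : (V → F) → V → F) :
    lift ι (funMat f) = funMat fun x => Function.extend ι (f (x ∘ ι)) x := by
  ext x y
  simp only [lift, funMat, eq_extend_iff]
  have : (∀ w, w ∉ Set.range ι → y w = x w) ↔ ∀ w, w ∉ Set.range ι → x w = y w := by
    simp only [eq_comm]
  simp only [this]
  split_ifs <;> simp_all

/-- The tensor product of one-qudit matrices. -/
def tensor (U : W → Matrix F F ℂ) : Matrix (W → F) (W → F) ℂ :=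
  fun x y => ∏ i, U i (x i) (y i)

theorem tensor_mul (U U' : W → Matrix F F ℂ) :
    tensor U * tensor U' = tensor fun i => U i * U' i := by
  ext x y
  simp only [tensor, mul_apply, ← Finset.prod_mul_distrib]
  rw [Finset.prod_univ_sum]
  simp

theorem tensor_one : tensor (fun _ : W => (1 : Matrix F F ℂ)) = 1 := by
  ext x y
  simp only [tensor, one_apply, Finset.prod_ite_zero, Finset.prod_const_one, Finset.mem_univ,
    forall_true_left, funext_iff]

theorem tensor_mem_unitary {U : W → Matrix F F ℂ} (hU : ∀ i, U i ∈ unitaryGroup F ℂ) :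
    tensor U ∈ unitaryGroup (W → F) ℂ := by
  have h : star (tensor U) = tensor fun i => star (U i) := by
    ext x y
    simp [tensor, star_apply]
  rw [mem_unitaryGroup_iff, h, tensor_mul, ← tensor_one]
  congr 1
  funext i
  exact mem_unitaryGroup_iff.1 (hU i)

/-! ### Circuits as products of gates -/

/-- `Impl c M`: the matrix `M` is a product of gates of total cost at most `c`. -/
inductive Impl : ℕ → Matrix (W → F) (W → F) ℂ → Prop
  | one (c : ℕ) : Impl c 1
  | gate (r : ℕ) (hr : r ≤ 3) (ι : Fin r ↪ W) (U : Matrix (Fin r → F) (Fin r → F) ℂ)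
      (hU : U ∈ unitaryGroup (Fin r → F) ℂ) (c : ℕ) (M : Matrix (W → F) (W → F) ℂ)
      (hM : Impl c M) : Impl (Fintype.card F ^ (2 * r) + c) (lift ι U * M)

theorem Impl.mono {c d : ℕ} {M : Matrix (W → F) (W → F) ℂ} (h : Impl c M) (hcd : c ≤ d) :
    Impl d M := by
  induction h generalizing d with
  | one c => exact .one d
  | gate r hr ι U hU c M hM ih =>
    obtain ⟨e, rfl⟩ := Nat.exists_eq_add_of_le hcd
    rw [add_assoc]
    exact .gate r hr ι U hU _ M (ih (by omega))

theorem Impl.mul {c d : ℕ} {M N : Matrix (W → F) (W → F) ℂ} (hM : Impl c M) (hN : Impl d N) :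
    Impl (c + d) (M * N) := by
  induction hM with
  | one c => rw [one_mul]; exact hN.mono (by omega)
  | gate r hr ι U hU c M hM ih =>
    rw [mul_assoc, add_assoc]
    exact .gate r hr ι U hU _ _ ih

theorem Impl.of_gate {r : ℕ} (hr : r ≤ 3) (ι : Fin r ↪ W) {U : Matrix (Fin r → F) (Fin r → F) ℂ}
    (hU : U ∈ unitaryGroup (Fin r → F) ℂ) : Impl (Fintype.card F ^ (2 * r)) (lift ι U) := by
  simpa using Impl.gate r hr ι U hU 0 1 (.one 0)

/-- Reversing the order and inverting each gate leaves the cost unchanged, so uncomputation costs as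
much as computation. -/
theorem Impl.conjTranspose {c : ℕ} {M : Matrix (W → F) (W → F) ℂ} (hM : Impl c M) :
    Impl c Mᴴ := by
  induction hM with
  | one c => rw [conjTranspose_one]; exact .one c
  | gate r hr ι U hU c M hM ih =>
    rw [conjTranspose_mul, lift_conjTranspose, add_comm]
    refine ih.mul (.of_gate hr ι ?_)
    rw [← star_eq_conjTranspose]
    exact Unitary.star_mem hU

theorem Impl.mem_unitary {c : ℕ} {M : Matrix (W → F) (W → F) ℂ} (hM : Impl c M) :
    M ∈ unitaryGroup (W → F) ℂ := by
  induction hM with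
  | one c => exact one_mem _
  | gate r hr ι U hU c M hM ih => exact mul_mem (lift_mem_unitary ι hU) ih

theorem Impl.lift {c : ℕ} {M : Matrix (V → F) (V → F) ℂ} (hM : Impl c M) (ι : V ↪ W) :
    Impl c (lift ι M) := by
  induction hM with
  | one c => rw [lift_one]; exact .one c
  | gate r hr κ U hU c M hM ih =>
    rw [lift_mul, lift_lift]
    exact .gate r hr _ U hU _ _ ih

theorem Impl.pow {c : ℕ} {M : Matrix (W → F) (W → F) ℂ} (hM : Impl c M) (m : ℕ) :
    Impl (m * c) (M ^ m) := by
  induction m with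
  | zero => rw [pow_zero]; exact .one _
  | succ m ih => rw [pow_succ, Nat.succ_mul]; exact ih.mul hM

theorem Impl.tensor {U : W → Matrix F F ℂ} (hU : ∀ i, U i ∈ unitaryGroup F ℂ) :
    Impl (Fintype.card W * Fintype.card F ^ 2) (tensor U) := by
  suffices h : ∀ S : Finset W, Impl (S.card * Fintype.card F ^ 2)
      (QuditRS.tensor fun i => if i ∈ S then U i else 1) by
    simpa using h Finset.univ
  intro S
  induction S using Finset.induction_on with
  | empty => simpa [tensor_one] using Impl.one 0
  | insert a S ha ih =>
    rw [Finset.card_insert_of_notMem ha, Nat.succ_mul, add_comm]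
    have hι : Function.Injective fun _ : Fin 1 => a := fun i j _ => Subsingleton.elim i j
    have hmem : (QuditRS.tensor fun _ : Fin 1 => U a) ∈ unitaryGroup (Fin 1 → F) ℂ :=
      tensor_mem_unitary fun _ => hU a
    have key : QuditRS.tensor (fun i => if i = a then U i else 1) =
        QuditRS.lift ⟨_, hι⟩ (QuditRS.tensor fun _ : Fin 1 => U a) := by
      ext x y
      simp only [QuditRS.tensor, QuditRS.lift, Function.Embedding.coeFn_mk, Set.range_const,
        Set.mem_singleton_iff]
      rw [← Finset.mul_prod_erase Finset.univ _ (Finset.mem_univ a)]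
      have : ∏ w ∈ Finset.univ.erase a, (if w = a then U w else 1) (x w) (y w) =
          if ∀ w, ¬ w = a → x w = y w then 1 else 0 := by
        rw [Finset.prod_congr rfl (g := fun w => if x w = y w then (1 : ℂ) else 0)]
        · rw [Finset.prod_ite_zero, Finset.prod_const_one]
          simp
        · intro w hw
          rw [if_neg (Finset.ne_of_mem_erase hw), one_apply]
      rw [this, if_pos rfl]
      split_ifs <;> simp
    have hgate := Impl.of_gate (by norm_num : 1 ≤ 3) ⟨_, hι⟩ hmem
    rw [← key] at hgate
    have := hgate.mul ih
    rw [tensor_mul] at this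
    convert this using 3 with i
    by_cases hi : i = a
    · subst hi; simp [ha]
    · simp [hi]

end Register

/-! ### Classical gates, shears and reflections -/

section Classical

variable {F : Type*} [Field F] [Fintype F] [DecidableEq F]
variable {V W : Type} [Fintype V] [DecidableEq V] [Fintype W] [DecidableEq W]

/-- A target wire together with at most two control wires fits in one gate. Adding a function of the
controls is reversible, because the controls are left alone and the function can be subtracted
again. -/
theorem Impl.funMat_update {r : ℕ} (hr : r ≤ 2) (ι : Fin r ↪ W) (t : W) (ht : t ∉ Set.range ι)
    (G : (Fin r → F) → F) :
    Impl (Fintype.card F ^ (2 * (r + 1)))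
      (funMat fun x : W → F => Function.update x t (x t + G (x ∘ ι))) := by
  let κ : Fin (r + 1) ↪ W := ⟨Fin.cons t ι, Fin.cons_injective_iff.2 ⟨ht, ι.injective⟩⟩
  -- The scalar `s` treats the gate (`s = 1`) and its inverse (`s = -1`) together.
  let φ : F → (Fin (r + 1) → F) → Fin (r + 1) → F :=
    fun s z => Function.update z 0 (z 0 + s * G (z ∘ Fin.succ))
  have hsucc (s : F) (z : Fin (r + 1) → F) : φ s z ∘ Fin.succ = z ∘ Fin.succ := by
    funext i
    simp [φ, Fin.succ_ne_zero]
  have hinv (s : F) (z : Fin (r + 1) → F) : φ (-s) (φ s z) = z := by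
    have h0 : φ s z 0 = z 0 + s * G (z ∘ Fin.succ) := by simp [φ]
    funext i
    refine Fin.cases ?_ (fun i => ?_) i
    · change Function.update (φ s z) 0 (φ s z 0 + -s * G (φ s z ∘ Fin.succ)) 0 = _
      rw [Function.update_self, hsucc, h0]
      ring
    · simp [φ, Fin.succ_ne_zero]
  have hU : funMat (φ 1) ∈ unitaryGroup (Fin (r + 1) → F) ℂ :=
    funMat_mem_unitary (g := φ (-1)) (fun x => by simpa using hinv (-1) x) (hinv 1)
  have h := Impl.of_gate (by omega) κ hU
  rw [lift_funMat] at h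
  convert h using 2
  funext x
  refine (eq_extend_iff κ _ _ _).2 ⟨?_, fun w hw => ?_⟩
  · funext i
    refine Fin.cases ?_ (fun i => ?_) i
    · simp only [Function.comp_apply, κ, φ, Function.Embedding.coeFn_mk, Fin.cons_zero,
        Function.update_self, one_mul]
      rfl
    · have : ι i ≠ t := fun h => ht ⟨i, h⟩
      simp [κ, φ, Fin.succ_ne_zero, Function.update_of_ne this]
  · rw [Function.update_of_ne]
    rintro rfl
    exact hw ⟨0, rfl⟩

theorem Impl.funMat_add_mul {t s : W} (hts : t ≠ s) (l : F) :
    Impl (Fintype.card F ^ 4) (funMat fun x : W → F => Function.update x t (x t + l * x s)) := by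
  refine Impl.funMat_update (r := 1) (by norm_num)
    ⟨fun _ => s, fun i j _ => Subsingleton.elim i j⟩ t ?_ fun z => l * z 0
  rintro ⟨_, h⟩
  exact hts h.symm

/-- Adding a linear function of some wires to other wires. -/
theorem Impl.shear (T : Set W) (B : Matrix W W F) (hB : ∀ t s, B t s ≠ 0 → t ∈ T ∧ s ∉ T) :
    Impl (Fintype.card W * Fintype.card W * Fintype.card F ^ 4)
      (funMat fun x : W → F => x + B *ᵥ x) := by
  let R : Finset (W × W) → Matrix W W F := fun S t s => if (t, s) ∈ S then B t s else 0
  suffices h : ∀ S : Finset (W × W), Impl (S.card * Fintype.card F ^ 4)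
      (funMat fun x : W → F => x + R S *ᵥ x) by
    have hR : R Finset.univ = B := by
      ext t s
      simp [R]
    simpa [hR] using h Finset.univ
  intro S
  induction S using Finset.induction_on with
  | empty =>
    have hR : R ∅ = 0 := by
      ext t s
      simp [R]
    have : (fun x : W → F => x + R ∅ *ᵥ x) = id := by
      funext x
      simp [hR]
    rw [this, funMat_id]
    exact .one _
  | insert p S hp ih =>
    obtain ⟨t, s⟩ := p
    rw [Finset.card_insert_of_notMem hp, Nat.succ_mul, add_comm]
    by_cases h0 : B t s = 0
    · have hR : R (insert (t, s) S) = R S := by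
        ext t' s'
        by_cases h : (t', s') = (t, s)
        · simp only [Prod.mk.injEq] at h
          obtain ⟨rfl, rfl⟩ := h
          simp [R, h0]
        · simp [R, h]
      rw [hR]
      exact ih.mono (by omega)
    · obtain ⟨htT, hsT⟩ := hB t s h0
      have hts : t ≠ s := by
        rintro rfl
        exact hsT htT
      have := (Impl.funMat_add_mul hts (B t s)).mul ih
      rw [← funMat_comp] at this
      convert this using 2
      funext x w
      -- Sources lie outside `T`, so the earlier additions have not altered wire `s` and the new one
      -- reads its original value.
      have hs0 : (R S *ᵥ x) s = 0 := by
        refine Finset.sum_eq_zero fun j _ => ?_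
        have : B s j = 0 := by
          by_contra h
          exact hsT (hB s j h).1
        simp [R, this]
      have hRw : (R (insert (t, s) S) *ᵥ x) w =
          (R S *ᵥ x) w + if w = t then B t s * x s else 0 := by
        have : (if w = t then B t s * x s else 0) =
            ∑ j, if w = t ∧ j = s then B t s * x s else 0 := by
          by_cases hw : w = t <;> simp [hw]
        rw [this]
        simp only [mulVec, dotProduct, ← Finset.sum_add_distrib]
        refine Finset.sum_congr rfl fun j _ => ?_
        by_cases h : w = t ∧ j = s
        · obtain ⟨rfl, rfl⟩ := h
          simp [R, hp]
        · simp [R, h]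
      rw [Pi.add_apply, hRw, Function.comp_apply]
      by_cases hw : w = t
      · subst hw
        simp [hs0]
        ring
      · simp [hw]

theorem lift_diagonal (ι : V ↪ W) (d : (V → F) → ℂ) :
    lift ι (diagonal d) = diagonal fun x => d (x ∘ ι) := by
  ext x y
  by_cases h : x = y
  · subst h
    simp [lift]
  · rw [diagonal_apply_ne _ h]
    simp only [lift]
    split_ifs with h1
    · rw [diagonal_apply_ne]
      intro h2
      apply h
      funext w
      by_cases hw : w ∈ Set.range ι
      · obtain ⟨v, rfl⟩ := hw
        exact congrFun h2 v
      · exact h1 w hw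
    · rfl

/-- A conjunction of `r` tests is computed with three-qudit gates by carrying the partial result
along clean flags: each new flag depends on the previous flag and one tested wire. Zero encodes
"true so far", so the fresh flag `b 0` is already right for the empty conjunction, and `r` tests
need `r + 1` flags. -/
theorem exists_chain (r : ℕ) (c : Fin r ↪ W) (b : Fin (r + 1) ↪ W) (hcb : ∀ i j, c i ≠ b j)
    (Z : Fin r → Set F) :
    ∃ f g : (W → F) → W → F, (∀ x, f (g x) = x) ∧ (∀ x, g (f x) = x) ∧
      Impl (r * Fintype.card F ^ 6) (funMat f) ∧
      (∀ x w, w ∉ Set.range b → f x w = x w) ∧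
      ∀ x, (∀ i, x (b i) = 0) → (f x (b (Fin.last r)) = 0 ↔ ∀ i, x (c i) ∈ Z i) := by
  classical
  induction r with
  | zero =>
    refine ⟨id, id, fun _ => rfl, fun _ => rfl, ?_, fun _ _ _ => rfl, fun x hx => ?_⟩
    · rw [funMat_id]; exact .one _
    · simpa using hx 0
  | succ r ih =>
    obtain ⟨f, g, hfg, hgf, hI, hf, hfl⟩ := ih (Fin.castSuccEmb.trans c) (Fin.castSuccEmb.trans b)
      (fun i j => hcb _ _) (fun i => Z i.castSucc)
    let t := b (Fin.last (r + 1))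
    let w₁ := b (Fin.last r).castSucc
    let w₂ := c (Fin.last r)
    have ht1 : w₁ ≠ t := fun h => (Fin.castSucc_lt_last _).ne (b.injective h)
    have ht2 : w₂ ≠ t := hcb _ _
    have h12 : w₁ ≠ w₂ := (hcb _ _).symm
    let G : F → F → F := fun u v => if u = 0 ∧ v ∈ Z (Fin.last r) then 0 else 1
    let e : F → (W → F) → W → F := fun l x => Function.update x t (x t + l * G (x w₁) (x w₂))
    have hinv (l : F) (x : W → F) : e (-l) (e l x) = x := by
      funext w
      by_cases hw : w = t
      · subst hw
        simp [e, ht1, ht2]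
      · simp [e, hw]
    have hIe : Impl (Fintype.card F ^ 6) (funMat (e 1)) := by
      have hinj : Function.Injective ![w₁, w₂] := by
        intro i j
        fin_cases i <;> fin_cases j <;> simp [h12, h12.symm]
      have := Impl.funMat_update (r := 2) le_rfl ⟨![w₁, w₂], hinj⟩ t
        (by rintro ⟨i, hi⟩; fin_cases i; exacts [ht1 hi, ht2 hi]) fun z => G (z 0) (z 1)
      convert this using 2
      funext x
      simp [e]
    have htr : t ∉ Set.range (Fin.castSuccEmb.trans b) := by
      rintro ⟨i, hi⟩
      exact (Fin.castSucc_lt_last i).ne (b.injective hi)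
    have hwr : w₂ ∉ Set.range (Fin.castSuccEmb.trans b) := by
      rintro ⟨i, hi⟩
      exact hcb _ _ hi.symm
    refine ⟨e 1 ∘ f, g ∘ e (-1), fun x => ?_, fun x => ?_, ?_, fun x w hw => ?_, fun x hx => ?_⟩
    · simpa [hfg] using hinv (-1) x
    · simp [hinv, hgf]
    · rw [funMat_comp, Nat.succ_mul, add_comm]
      exact hIe.mul hI
    · have hwt : w ≠ t := by
        rintro rfl
        exact hw ⟨_, rfl⟩
      simp only [Function.comp_apply, e, Function.update_of_ne hwt]
      refine hf x w ?_
      rintro ⟨i, rfl⟩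
      exact hw ⟨_, rfl⟩
    · have h1 := hfl x fun i => hx _
      change f x w₁ = 0 ↔ _ at h1
      change e 1 (f x) t = 0 ↔ _
      simp only [e, Function.update_self, one_mul, hf x t htr, hf x w₂ hwr]
      rw [show x t = 0 from hx _, zero_add]
      simp only [G, ite_eq_left_iff, one_ne_zero, imp_false, not_not, h1, Fin.forall_fin_succ']
      rfl

/-- Compute the conjunction, put a sign on its last flag, and uncompute. The result is diagonal on
the whole space; its entries are only needed where the flags are clean. -/
theorem exists_reflection (r : ℕ) (c : Fin r ↪ W) (b : Fin (r + 1) ↪ W)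
    (hcb : ∀ i j, c i ≠ b j) (Z : Fin r → Set F) :
    ∃ d : (W → F) → ℂ, Impl ((2 * r + 1) * Fintype.card F ^ 6) (diagonal d) ∧
      (∀ x, (∀ i, x (b i) = 0) → (∀ i, x (c i) ∈ Z i) → d x = 1) ∧
      (∀ x, (∀ i, x (b i) = 0) → ¬ (∀ i, x (c i) ∈ Z i) → d x = -1) := by
  obtain ⟨f, g, hfg, hgf, hI, hf, hfl⟩ := exists_chain r c b hcb Z
  let t := b (Fin.last r)
  let ι : Fin 1 ↪ W := ⟨fun _ => t, fun i j _ => Subsingleton.elim i j⟩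
  let p : F → ℂ := fun u => if u = 0 then 1 else -1
  have hU : diagonal (fun z : Fin 1 → F => p (z 0)) ∈ unitaryGroup (Fin 1 → F) ℂ := by
    rw [mem_unitaryGroup_iff, star_eq_conjTranspose, diagonal_conjTranspose, diagonal_mul_diagonal,
      ← diagonal_one]
    congr 1
    funext z
    simp only [p, Pi.star_apply]
    split_ifs <;> simp
  have hD := Impl.of_gate (by norm_num) ι hU
  rw [lift_diagonal] at hD
  have hmat : (funMat f)ᴴ * (diagonal (fun x : W → F => p (x t)) * funMat f) =
      diagonal fun x => p (f x t) := by
    rw [funMat_conjTranspose hfg hgf]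
    refine ext_mulVec fun ψ => ?_
    rw [← mulVec_mulVec, ← mulVec_mulVec]
    funext x
    rw [funMat_mulVec hgf hfg, mulVec_diagonal, mulVec_diagonal, funMat_mulVec hfg hgf, hgf]
  refine ⟨fun x => p (f x t), ?_, fun x hx hZ => ?_, fun x hx hZ => ?_⟩
  · rw [← hmat]
    refine (hI.conjTranspose.mul (hD.mul hI)).mono ?_
    have : Fintype.card F ^ (2 * 1) ≤ Fintype.card F ^ 6 :=
      Nat.pow_le_pow_right Fintype.card_pos (by norm_num)
    nlinarith
  · exact if_pos ((hfl x hx).2 hZ)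
  · exact if_neg fun h => hZ ((hfl x hx).1 h)

end Classical

/-! ### Circuits and matrices -/

section Circuit

variable {F : Type*} [Fintype F] [DecidableEq F]

theorem Gate.apply_eq {m : ℕ} (g : Gate F m) (ψ : State F m) :
    g.apply ψ = lift g.wires (g.U : Matrix (Fin g.arity → F) (Fin g.arity → F) ℂ) *ᵥ ψ := by
  funext x
  rw [lift_mulVec]
  rfl

theorem exists_impl_of_gates {m : ℕ} (l : List (Gate F m)) :
    ∃ M : Matrix (Fin m → F) (Fin m → F) ℂ, Impl (l.map Gate.cost).sum M ∧
      ∀ ψ, l.foldl (fun φ g => g.apply φ) ψ = M *ᵥ ψ := by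
  induction l with
  | nil => exact ⟨1, .one _, fun ψ => by simp⟩
  | cons g l ih =>
    obtain ⟨M, hM, h⟩ := ih
    refine ⟨M * lift g.wires (g.U : Matrix _ _ ℂ), ?_, fun ψ => ?_⟩
    · rw [List.map_cons, List.sum_cons, add_comm]
      exact hM.mul (Impl.of_gate g.arity_le g.wires g.U.2)
    · rw [List.foldl_cons, h, Gate.apply_eq, mulVec_mulVec]

theorem Impl.exists_gates {m c : ℕ} {M : Matrix (Fin m → F) (Fin m → F) ℂ} (hM : Impl c M) :
    ∃ l : List (Gate F m), (l.map Gate.cost).sum ≤ c ∧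
      ∀ ψ, l.foldl (fun φ g => g.apply φ) ψ = M *ᵥ ψ := by
  induction hM with
  | one c => exact ⟨[], by simp, fun ψ => by simp⟩
  | gate r hr ι U hU c M hM ih =>
    obtain ⟨l, hl, h⟩ := ih
    refine ⟨l ++ [⟨r, hr, ι, ⟨U, hU⟩⟩], ?_, fun ψ => ?_⟩
    · simp only [List.map_append, List.sum_append, List.map_cons, List.map_nil, List.sum_singleton]
      rw [add_comm]
      exact Nat.add_le_add_left hl _
    · rw [List.foldl_append, h, List.foldl_cons, List.foldl_nil, Gate.apply_eq, mulVec_mulVec]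

end Circuit

/-! ### Amplitude amplification -/

section Amplification

variable {X : Type*} [Fintype X] [DecidableEq X]

theorem star_mulVec_dotProduct_mulVec {U : Matrix X X ℂ} (hU : U ∈ unitaryGroup X ℂ)
    (φ ψ : X → ℂ) : star (U *ᵥ φ) ⬝ᵥ (U *ᵥ ψ) = star φ ⬝ᵥ ψ := by
  rw [mem_unitaryGroup_iff', star_eq_conjTranspose] at hU
  rw [star_mulVec, dotProduct_mulVec, vecMul_vecMul, hU, vecMul_one]

theorem star_dotProduct_self (ψ : X → ℂ) : star ψ ⬝ᵥ ψ = ((∑ x, ‖ψ x‖ ^ 2 : ℝ) : ℂ) := by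
  simp only [dotProduct, Pi.star_apply, Complex.ofReal_sum]
  refine Finset.sum_congr rfl fun x _ => ?_
  rw [Complex.star_def, Complex.conj_mul', Complex.ofReal_pow]

theorem sum_norm_sq_mulVec {U : Matrix X X ℂ} (hU : U ∈ unitaryGroup X ℂ) (ψ : X → ℂ) :
    ∑ x, ‖(U *ᵥ ψ) x‖ ^ 2 = ∑ x, ‖ψ x‖ ^ 2 := by
  have := star_mulVec_dotProduct_mulVec hU ψ ψ
  rw [star_dotProduct_self, star_dotProduct_self] at this
  exact_mod_cast this

theorem norm_star_dotProduct_le (φ ψ : X → ℂ) :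
    ‖star φ ⬝ᵥ ψ‖ ≤ √(∑ x, ‖φ x‖ ^ 2) * √(∑ x, ‖ψ x‖ ^ 2) := by
  refine le_trans (norm_sum_le _ _) ?_
  simp only [norm_mul, Pi.star_apply, norm_star]
  exact Real.sum_mul_le_sqrt_mul_sqrt _ _ _

/-- Reflection about the image of a basis vector under a unitary. -/
theorem reflection_mulVec {U : Matrix X X ℂ} (hU : U ∈ unitaryGroup X ℂ) (x₀ : X) (v : X → ℂ) :
    (U * diagonal (fun x => if x = x₀ then (1 : ℂ) else -1) * Uᴴ) *ᵥ v =
      (2 * (star (U *ᵥ Pi.single x₀ 1) ⬝ᵥ v)) • (U *ᵥ Pi.single x₀ 1) - v := by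
  have hd (w : X → ℂ) : diagonal (fun x => if x = x₀ then (1 : ℂ) else -1) *ᵥ w =
      (2 * w x₀) • Pi.single x₀ (1 : ℂ) - w := by
    funext x
    rw [mulVec_diagonal]
    by_cases h : x = x₀
    · subst h
      simp
      ring
    · simp [h]
  have hw : (Uᴴ *ᵥ v) x₀ = star (U *ᵥ Pi.single x₀ 1) ⬝ᵥ v := by
    simp [mulVec, dotProduct, conjTranspose_apply]
  rw [mem_unitaryGroup_iff, star_eq_conjTranspose] at hU
  rw [← mulVec_mulVec, ← mulVec_mulVec, hd, hw, mulVec_sub, mulVec_smul, mulVec_mulVec, hU,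
    one_mulVec]

/-- Exact amplitude amplification. -/
theorem amplification {U : Matrix X X ℂ} (hU : U ∈ unitaryGroup X ℂ) (x₀ : X) (G : Set X)
    [DecidablePred (· ∈ G)]
    {m : ℕ} (hm : 1 ≤ m)
    (hG : ∑ x, (if x ∈ G then ‖(U *ᵥ Pi.single x₀ 1) x‖ ^ 2 else 0) =
      Real.sin (Real.pi / (2 * (2 * m + 1))) ^ 2) :
    ((U * diagonal (fun x => if x = x₀ then (1 : ℂ) else -1) * Uᴴ *
        diagonal (fun x => if x ∈ G then (1 : ℂ) else -1)) ^ m) *ᵥ (U *ᵥ Pi.single x₀ 1) =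
      fun x => (-1) ^ m * if x ∈ G then
        (U *ᵥ Pi.single x₀ 1) x / (Real.sin (Real.pi / (2 * (2 * m + 1))) : ℝ) else 0 := by
  set Ψ := U *ᵥ Pi.single x₀ 1 with hΨ
  set θ : ℝ := Real.pi / (2 * (2 * m + 1)) with hθ
  have hm' : (1 : ℝ) ≤ m := by exact_mod_cast hm
  have hθ0 : 0 < θ := by positivity
  have hθ1 : θ < Real.pi / 2 := by
    rw [hθ]
    apply div_lt_div_of_pos_left Real.pi_pos <;> linarith
  have hs : 0 < Real.sin θ := Real.sin_pos_of_pos_of_lt_pi hθ0 (by linarith [Real.pi_pos])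
  have hc : 0 < Real.cos θ := Real.cos_pos_of_mem_Ioo ⟨by linarith, hθ1⟩
  have h1 : ∑ x, ‖Ψ x‖ ^ 2 = 1 := by
    rw [sum_norm_sq_mulVec hU, Finset.sum_eq_single x₀] <;> simp +contextual
  have hB : ∑ x, (if x ∈ G then 0 else ‖Ψ x‖ ^ 2) = Real.cos θ ^ 2 := by
    rw [Real.cos_sq', ← hG, ← h1, ← Finset.sum_sub_distrib]
    refine Finset.sum_congr rfl fun x _ => ?_
    split_ifs <;> simp
  -- The iteration stays in the plane spanned by the good and bad parts of `Ψ`; `a` and `b` are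
  -- coordinates relative to those unnormalised parts.
  let v : ℝ → ℝ → X → ℂ := fun a b x => ((if x ∈ G then a else b : ℝ) : ℂ) * Ψ x
  have hin (a b : ℝ) : star Ψ ⬝ᵥ v a b =
      ((a * Real.sin θ ^ 2 + b * Real.cos θ ^ 2 : ℝ) : ℂ) := by
    rw [← hG, ← hB, Finset.mul_sum, Finset.mul_sum, ← Finset.sum_add_distrib, Complex.ofReal_sum]
    refine Finset.sum_congr rfl fun x _ => ?_
    have : star (Ψ x) * Ψ x = ((‖Ψ x‖ ^ 2 : ℝ) : ℂ) := by
      rw [Complex.star_def, Complex.conj_mul']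
      norm_cast
    simp only [v, Pi.star_apply]
    rw [mul_left_comm, this, ← Complex.ofReal_mul]
    split_ifs <;> simp
  have hstep (a b : ℝ) : (U * diagonal (fun x => if x = x₀ then (1 : ℂ) else -1) * Uᴴ *
        diagonal (fun x => if x ∈ G then (1 : ℂ) else -1)) *ᵥ v a b =
      v (2 * (a * Real.sin θ ^ 2 - b * Real.cos θ ^ 2) - a)
        (2 * (a * Real.sin θ ^ 2 - b * Real.cos θ ^ 2) + b) := by
    have hd : diagonal (fun x => if x ∈ G then (1 : ℂ) else -1) *ᵥ v a b = v a (-b) := by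
      funext x
      rw [mulVec_diagonal]
      simp only [v]
      split_ifs <;> simp
    rw [← mulVec_mulVec, hd, reflection_mulVec hU, ← hΨ, hin]
    funext x
    simp only [v, Pi.sub_apply, Pi.smul_apply, smul_eq_mul]
    split_ifs <;> push_cast <;> ring
  -- Each round rotates by `2θ`. It also contributes a factor `-1`, because the reflection used
  -- fixes the good set and negates its complement.
  have hpow (j : ℕ) : ((U * diagonal (fun x => if x = x₀ then (1 : ℂ) else -1) * Uᴴ *
        diagonal (fun x => if x ∈ G then (1 : ℂ) else -1)) ^ j) *ᵥ Ψ =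
      v ((-1) ^ j * (Real.sin ((2 * j + 1) * θ) / Real.sin θ))
        ((-1) ^ j * (Real.cos ((2 * j + 1) * θ) / Real.cos θ)) := by
    induction j with
    | zero =>
      funext x
      simp [v, hs.ne', hc.ne']
    | succ j ih =>
      rw [pow_succ', ← mulVec_mulVec, ih, hstep]
      have e : (2 * ((j + 1 : ℕ) : ℝ) + 1) * θ = (2 * j + 1) * θ + 2 * θ := by push_cast; ring
      have hsc := Real.sin_sq_add_cos_sq θ
      congr 1
      · rw [e, Real.sin_add, Real.cos_two_mul', Real.sin_two_mul, pow_succ]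
        have : Real.cos θ ^ 2 = 1 - Real.sin θ ^ 2 := by linarith
        field_simp
        rw [this]
        ring
      · rw [e, Real.cos_add, Real.cos_two_mul, Real.sin_two_mul, pow_succ]
        field_simp
        ring
  rw [hpow]
  -- The angle was chosen so that `m` rounds end exactly at `π / 2`, with no bad component left.
  have hend : (2 * (m : ℝ) + 1) * θ = Real.pi / 2 := by
    rw [hθ]; field_simp
  funext x
  simp only [v, hend, Real.sin_pi_div_two, Real.cos_pi_div_two]
  split_ifs
  · push_cast; ring
  · simp

end Amplification

/-! ### Reed-Solomon codes with full support -/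

section ReedSolomon

variable {F : Type*} [Field F]

/-- The encoding matrix of the Reed-Solomon code of dimension `K`. -/
def enc {n : ℕ} (α : Fin n → F) (K : ℕ) : Matrix (Fin n) (Fin K) F := fun i j => α i ^ (j : ℕ)

theorem mem_reedSolomon_iff {n : ℕ} (α : Fin n → F) (K : ℕ) (c : Fin n → F) :
    c ∈ reedSolomon α K ↔ ∃ a : Fin K → F, enc α K *ᵥ a = c := by
  have key (p : Polynomial F) (hp : p ∈ Polynomial.degreeLT F K) :
      (LinearMap.pi fun i => Polynomial.leval (α i)) p =
        enc α K *ᵥ Polynomial.degreeLTEquiv F K ⟨p, hp⟩ := by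
    funext i
    simp only [LinearMap.pi_apply, Polynomial.leval_apply, Polynomial.eval_eq_sum_degreeLTEquiv hp,
      mulVec, dotProduct, enc, mul_comm]
  rw [reedSolomon, Submodule.mem_map]
  constructor
  · rintro ⟨p, hp, rfl⟩
    exact ⟨_, (key p hp).symm⟩
  · rintro ⟨a, rfl⟩
    refine ⟨(Polynomial.degreeLTEquiv F K).symm a, Subtype.property _, ?_⟩
    rw [key _ (Subtype.property _)]
    simp

theorem enc_injective {n : ℕ} {α : Fin n → F} (hα : Function.Injective α) {K : ℕ} (hK : K ≤ n) :
    Function.Injective fun a : Fin K → F => enc α K *ᵥ a := by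
  intro a b hab
  apply (Polynomial.degreeLTEquiv F K).symm.injective
  apply Subtype.ext
  have hdeg (a : Fin K → F) :
      (((Polynomial.degreeLTEquiv F K).symm a : Polynomial.degreeLT F K) : Polynomial F).degree <
        ((Finset.univ : Finset (Fin n)).card : WithBot ℕ) := by
    refine lt_of_lt_of_le (Polynomial.mem_degreeLT.1 (Subtype.property _)) ?_
    simpa using hK
  refine Polynomial.eq_of_degrees_lt_of_eval_index_eq Finset.univ hα.injOn (hdeg a) (hdeg b)
    fun i _ => ?_
  rw [Polynomial.eval_eq_sum_degreeLTEquiv (Subtype.property _),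
    Polynomial.eval_eq_sum_degreeLTEquiv (Subtype.property _)]
  have := congrFun hab i
  simpa [mulVec, dotProduct, enc, mul_comm] using this

/-- A linear decoder defined on all words lets the message be subtracted by a shear, without testing
whether the output is a codeword. -/
theorem exists_enc_leftInverse {n : ℕ} {α : Fin n → F} (hα : Function.Injective α) {K : ℕ}
    (hK : K ≤ n) : ∃ L : Matrix (Fin K) (Fin n) F, ∀ a, L *ᵥ (enc α K *ᵥ a) = a := by
  obtain ⟨g, hg⟩ := (enc α K).mulVecLin.exists_leftInverse_of_injective
    (LinearMap.ker_eq_bot.2 (enc_injective hα hK))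
  refine ⟨LinearMap.toMatrix' g, fun a => ?_⟩
  rw [LinearMap.toMatrix'_mulVec]
  exact LinearMap.congr_fun hg a

/-- Over the full support, words orthogonal to the Reed-Solomon code of dimension `q - k` belong
to the Reed-Solomon code of dimension `k`. -/
theorem mem_reedSolomon_of_orthogonal [Fintype F] {q : ℕ} (hq : Fintype.card F = q)
    (α : Fin q ≃ F) {k : ℕ} (hk : 1 ≤ k) (v : Fin q → F)
    (hv : v ᵥ* enc α (q - k) = 0) : v ∈ reedSolomon α k := by
  classical
  have hq0 : q - 1 ≠ 0 := by
    have := Fintype.one_lt_card (α := F)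
    omega
  -- This interpolates `v`: over a field of size `q`, `1 - (X - a) ^ (q - 1)` is the indicator
  -- function of `a`.
  let g : Polynomial F := ∑ i, Polynomial.C (v i) *
    (1 - (Polynomial.X + Polynomial.C (-α i)) ^ (q - 1))
  refine ⟨g, ?_, ?_⟩
  · rw [SetLike.mem_coe, Polynomial.mem_degreeLT, Polynomial.degree_lt_iff_coeff_zero]
    intro m hm
    simp only [g, Polynomial.finsetSum_coeff, Polynomial.coeff_C_mul, Polynomial.coeff_sub,
      Polynomial.coeff_X_add_C_pow, Polynomial.coeff_one]
    -- The constant term `1` does not contribute in degree `m ≥ k ≥ 1`.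
    rw [if_neg (by omega)]
    by_cases hmq : q - 1 < m
    · simp [Nat.choose_eq_zero_of_lt hmq]
    -- Up to a scalar, the coefficient of `X ^ m` is the power sum of `v` with exponent `q - 1 - m`.
    -- This exponent is below `q - k` exactly because `m ≥ k`, so orthogonality kills the
    -- coefficient.
    · have := congrFun hv ⟨q - 1 - m, by omega⟩
      simp only [vecMul, dotProduct, enc, Pi.zero_apply] at this
      trans -(-1 : F) ^ (q - 1 - m) * ((q - 1).choose m : F) * ∑ i, v i * α i ^ (q - 1 - m)
      · rw [Finset.mul_sum]
        refine Finset.sum_congr rfl fun i _ => ?_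
        rw [neg_pow (α i)]
        ring
      · rw [this, mul_zero]
  · funext l
    simp only [LinearMap.pi_apply, Polynomial.leval_apply, g, Polynomial.eval_finsetSum,
      Polynomial.eval_mul, Polynomial.eval_C, Polynomial.eval_sub, Polynomial.eval_one,
      Polynomial.eval_pow, Polynomial.eval_add, Polynomial.eval_X]
    rw [Finset.sum_eq_single l]
    · simp [hq0]
    · intro i _ hi
      have : α l + -α i ≠ 0 := by
        rw [← sub_eq_add_neg, sub_ne_zero]
        exact fun h => hi (α.injective h.symm)
      have h1 := FiniteField.pow_card_sub_one_eq_one _ this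
      rw [hq] at h1
      simp [h1]
    · simp

end ReedSolomon

/-! ### Characters and the Fourier transform -/

section Fourier

variable {F : Type*} [Field F] [Fintype F] [DecidableEq F]

theorem addChar_sum_apply {ι : Type*} (χ : AddChar F ℂ) (s : Finset ι) (f : ι → F) :
    χ (∑ i ∈ s, f i) = ∏ i ∈ s, χ (f i) := by
  classical
  induction s using Finset.induction_on with
  | empty => simp
  | insert a s ha ih => rw [Finset.sum_insert ha, Finset.prod_insert ha, AddChar.map_add_eq_mul, ih]

theorem sum_addChar_dotProduct {ι : Type*} [Fintype ι] [DecidableEq ι] {χ : AddChar F ℂ}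
    (hχ : χ.IsPrimitive) (v : ι → F) :
    ∑ y : ι → F, χ (v ⬝ᵥ y) = if v = 0 then (Fintype.card F : ℂ) ^ Fintype.card ι else 0 := by
  have h : ∏ i, ∑ y : F, χ (v i * y) = ∑ y : ι → F, χ (v ⬝ᵥ y) := by
    rw [Finset.prod_univ_sum]
    simp [dotProduct, addChar_sum_apply]
  rw [← h]
  simp only [mul_comm (v _), AddChar.sum_mulShift _ hχ]
  split_ifs with hv
  · subst hv
    simp
  · obtain ⟨i, hi⟩ := Function.ne_iff.1 hv
    exact Finset.prod_eq_zero (Finset.mem_univ i) (by simpa using hi)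

/-- The discrete Fourier transform on one qudit. -/
def dft (χ : AddChar F ℂ) : Matrix F F ℂ :=
  fun x y => χ (x * y) / (√(Fintype.card F : ℝ) : ℝ)

theorem sqrt_card_mul_self (F : Type*) [Fintype F] :
    ((√(Fintype.card F : ℝ) : ℝ) : ℂ) * ((√(Fintype.card F : ℝ) : ℝ) : ℂ) = Fintype.card F := by
  rw [← Complex.ofReal_mul, Real.mul_self_sqrt (Nat.cast_nonneg _)]
  simp

theorem dft_mem_unitary {χ : AddChar F ℂ} (hχ : χ.IsPrimitive) :
    dft χ ∈ unitaryGroup F ℂ := by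
  rw [mem_unitaryGroup_iff]
  ext x y
  have hq : (Fintype.card F : ℂ) ≠ 0 := by simp
  have hterm (z : F) : dft χ x z * star (dft χ) z y =
      χ (z * (x - y)) / (Fintype.card F : ℂ) := by
    rw [star_apply, dft, dft, star_div₀, Complex.star_def, Complex.conj_ofReal,
      ← AddChar.map_neg_eq_conj, div_mul_div_comm, sqrt_card_mul_self, ← AddChar.map_add_eq_mul]
    congr 2
    ring
  rw [mul_apply, Finset.sum_congr rfl fun z _ => hterm z, ← Finset.sum_div,
    AddChar.sum_mulShift _ hχ]
  by_cases h : x = y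
  · subst h
    simp [hq]
  · simp [h, sub_ne_zero]

/-- The Fourier transform of the Bernoulli amplitude. -/
theorem norm_sq_dft_bernoulliAmp {χ : AddChar F ℂ} (hχ : χ.IsPrimitive) {τ : ℝ} (h0 : 0 < τ)
    (h1 : τ < 1 - 1 / (Fintype.card F : ℝ)) (b : F) :
    ‖((dft χ)ᴴ *ᵥ bernoulliAmp F τ) b‖ ^ 2 =
      if b = 0 then 1 - tauPerp (Fintype.card F) τ
      else tauPerp (Fintype.card F) τ / ((Fintype.card F : ℝ) - 1) := by
  set q := Fintype.card F with hq
  have hq1 : (1 : ℝ) < q := by exact_mod_cast Fintype.one_lt_card (α := F)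
  have hτ1 : τ < 1 := h1.trans_le (by simp)
  set A := √(1 - τ) with hA
  set B := √(τ / ((q : ℝ) - 1)) with hB
  have hA2 : A ^ 2 = 1 - τ := Real.sq_sqrt (by linarith)
  have hB2 : B ^ 2 = τ / ((q : ℝ) - 1) := Real.sq_sqrt (div_nonneg h0.le (by linarith))
  have hB2' : ((q : ℝ) - 1) * B ^ 2 = τ := by
    rw [hB2]
    field_simp [(by linarith : (q : ℝ) - 1 ≠ 0)]
  have hA0 : 0 ≤ A := Real.sqrt_nonneg _
  have hB0 : 0 ≤ B := Real.sqrt_nonneg _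
  have hsq : √(q : ℝ) ^ 2 = q := Real.sq_sqrt (by linarith)
  have hperp : tauPerp q τ = ((q : ℝ) - 1) / q * (A - B) ^ 2 := by
    have e1 : √(((q : ℝ) - 1) * (1 - τ)) = √((q : ℝ) - 1) * A := by
      rw [Real.sqrt_mul (by linarith)]
    have e2 : √τ = √((q : ℝ) - 1) * B := by
      rw [← Real.sqrt_mul (by linarith)]
      congr 1
      field_simp [(by linarith : (q : ℝ) - 1 ≠ 0)]
    rw [tauPerp, e1, e2, ← mul_sub, mul_pow, Real.sq_sqrt (by linarith)]
    ring
  have hval : ((dft χ)ᴴ *ᵥ bernoulliAmp F τ) b =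
      (((if b = 0 then A + ((q : ℝ) - 1) * B else A - B) / √(q : ℝ) : ℝ) : ℂ) := by
    -- A constant plus a point mass at `0` transforms into a point mass at `0` plus a constant, so
    -- the transform is again of Bernoulli shape.
    have hu (a : F) : bernoulliAmp F τ a = (B : ℂ) + if a = 0 then ((A - B : ℝ) : ℂ) else 0 := by
      rw [bernoulliAmp]
      split_ifs <;> simp [hA, hB, hq]
    have hterm (a : F) : (dft χ)ᴴ b a * bernoulliAmp F τ a =
        (χ (a * -b) * B + if a = 0 then ((A - B : ℝ) : ℂ) else 0) / (√(q : ℝ) : ℝ) := by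
      rw [hu, conjTranspose_apply, dft, star_div₀, Complex.star_def,
        Complex.conj_ofReal, ← AddChar.map_neg_eq_conj, ← mul_neg]
      by_cases ha : a = 0
      · subst ha
        simp
        ring
      · simp [ha]
        ring
    rw [mulVec, dotProduct, Finset.sum_congr rfl fun a _ => hterm a, ← Finset.sum_div,
      Finset.sum_add_distrib, ← Finset.sum_mul, AddChar.sum_mulShift _ hχ]
    by_cases hb : b = 0
    · simp [hb, ← hq]
      ring
    · simp [hb]
  rw [hval, Complex.norm_real, Real.norm_eq_abs, sq_abs, div_pow, hsq, hperp]
  split_ifs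
  · field_simp
    nlinarith
  · field_simp [(by linarith : (q : ℝ) - 1 ≠ 0)]

theorem tensor_mulVec_prod {ι : Type} [Fintype ι] [DecidableEq ι] (U : ι → Matrix F F ℂ)
    (u : ι → F → ℂ) (x : ι → F) :
    (tensor U *ᵥ fun e => ∏ i, u i (e i)) x = ∏ i, (U i *ᵥ u i) (x i) := by
  simp only [mulVec, dotProduct, tensor, ← Finset.prod_mul_distrib]
  rw [Finset.prod_univ_sum]
  simp

end Fourier

/-! ### A Chernoff bound -/

theorem exp_le_quadratic {x : ℝ} (h0 : 0 ≤ x) (h1 : x ≤ 2 / 3) :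
    Real.exp x ≤ 1 + x + 3 / 4 * x ^ 2 := by
  have h := Real.exp_bound' h0 (by linarith) (n := 3) (by norm_num)
  have e : ∑ m ∈ Finset.range 3, x ^ m / (m.factorial : ℝ) = 1 + x + x ^ 2 / 2 := by
    simp [Finset.sum_range_succ, Nat.factorial]
  rw [e] at h
  norm_num [Nat.factorial] at h
  nlinarith [mul_nonneg (sq_nonneg x) (by linarith : 0 ≤ 2 / 3 - x)]

/-- The exponential moment method with relative deviation `δ = μ ^ (-1/3)`, for which the exponent
`μ * δ ^ 2` equals `μ ^ (1/3)`. The assumption `1 ≤ μ` ensures `δ ≤ 1`. -/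
theorem chernoff {F : Type*} [Field F] [Fintype F] [DecidableEq F] {n : ℕ} {p μ : ℝ}
    (hp0 : 0 ≤ p) (hp1 : p ≤ 1) (hμ : p * n = μ) (hμ1 : 1 ≤ μ) :
    ∑ y : Fin n → F, (if (hammingNorm y : ℝ) ≤ μ * (1 + μ ^ (-(1 / 3 : ℝ))) then 0 else
      ∏ i, if y i = 0 then 1 - p else p / ((Fintype.card F : ℝ) - 1)) ≤
        Real.exp (-(μ ^ (1 / 3 : ℝ)) / 3) := by
  set δ := μ ^ (-(1 / 3 : ℝ)) with hδ
  have hμ0 : 0 < μ := by linarith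
  have hδ0 : 0 < δ := Real.rpow_pos_of_pos hμ0 _
  have hδ1 : δ ≤ 1 := Real.rpow_le_one_of_one_le_of_nonpos hμ1 (by norm_num)
  have hμδ : μ * δ ^ 2 = μ ^ (1 / 3 : ℝ) := by
    rw [hδ, ← Real.rpow_natCast, ← Real.rpow_mul hμ0.le]
    nth_rewrite 1 [← Real.rpow_one μ]
    rw [← Real.rpow_add hμ0]
    norm_num
  -- With `exp l ≤ 1 + l + 3/4 * l ^ 2`, this choice gives `exp l - 1 - l * (1 + δ) ≤ -δ ^ 2 / 3`;
  -- the quadratic bound applies as `l ≤ 2/3`.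
  set l := 2 / 3 * δ with hl
  have hl0 : 0 < l := by positivity
  have hq1 : (1 : ℝ) < Fintype.card F := by exact_mod_cast Fintype.one_lt_card (α := F)
  let w : F → ℝ := fun a => if a = 0 then 1 - p else p / ((Fintype.card F : ℝ) - 1)
  have hw (a : F) : 0 ≤ w a := by
    simp only [w]
    split_ifs
    · linarith
    · exact div_nonneg hp0 (by linarith)
  have hbound (y : Fin n → F) :
      (if (hammingNorm y : ℝ) ≤ μ * (1 + δ) then 0 else ∏ i, w (y i)) ≤
        (∏ i, w (y i) * (if y i = 0 then 1 else Real.exp l)) * Real.exp (-(l * (μ * (1 + δ)))) := by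
    have he : ∏ i, (if y i = 0 then 1 else Real.exp l) = Real.exp (l * hammingNorm y) := by
      rw [hammingNorm, mul_comm, Real.exp_nat_mul, ← Finset.prod_const, Finset.prod_filter]
      exact Finset.prod_congr rfl fun i _ => by by_cases h : y i = 0 <;> simp [h]
    rw [Finset.prod_mul_distrib, he, mul_assoc, ← Real.exp_add]
    have hprod : 0 ≤ ∏ i, w (y i) := Finset.prod_nonneg fun i _ => hw _
    split_ifs with h
    · positivity
    · refine le_mul_of_one_le_right hprod (Real.one_le_exp ?_)
      rw [not_le] at h
      nlinarith
  refine (Finset.sum_le_sum fun y _ => hbound y).trans ?_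
  rw [← Finset.sum_mul]
  have hfac : ∑ y : Fin n → F, ∏ i, w (y i) * (if y i = 0 then 1 else Real.exp l) =
      (1 + p * (Real.exp l - 1)) ^ n := by
    have h := Finset.prod_univ_sum (fun _ : Fin n => (Finset.univ : Finset F))
      fun _ a => w a * (if a = 0 then 1 else Real.exp l)
    rw [Fintype.piFinset_univ] at h
    rw [← h, Finset.prod_const, Finset.card_univ, Fintype.card_fin]
    congr 1
    rw [← Finset.add_sum_erase _ _ (Finset.mem_univ (0 : F)), Finset.sum_congr rfl
      (g := fun _ => p / ((Fintype.card F : ℝ) - 1) * Real.exp l)]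
    · rw [Finset.sum_const, Finset.card_erase_of_mem (Finset.mem_univ _), Finset.card_univ,
        nsmul_eq_mul, Nat.cast_sub Fintype.card_pos]
      simp only [w, if_true, Nat.cast_one]
      field_simp [(by linarith : (Fintype.card F : ℝ) - 1 ≠ 0)]
      ring
    · intro a ha
      simp [w, Finset.ne_of_mem_erase ha]
  have hexp : 0 ≤ Real.exp l - 1 := by linarith [Real.one_le_exp hl0.le]
  have hpow : (1 + p * (Real.exp l - 1)) ^ n ≤ Real.exp (μ * (Real.exp l - 1)) := by
    rw [← hμ, mul_comm p (n : ℝ), mul_assoc, Real.exp_nat_mul]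
    refine pow_le_pow_left₀ (by positivity) ?_ n
    linarith [Real.add_one_le_exp (p * (Real.exp l - 1))]
  rw [hfac]
  refine (mul_le_mul_of_nonneg_right hpow (Real.exp_pos _).le).trans ?_
  rw [← Real.exp_add, Real.exp_le_exp, ← hμδ]
  have := exp_le_quadratic hl0.le (by rw [hl]; linarith)
  have h2 : Real.exp l - 1 - l * (1 + δ) ≤ - δ ^ 2 / 3 := by
    rw [hl] at this ⊢
    nlinarith
  nlinarith

/-! ### The decoder run on noisy codewords -/

section Decoder

variable {F : Type*} [Field F] [Fintype F] [DecidableEq F]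

/-- The first `n` entries of a word of length `n + a`. -/
def inp {n a : ℕ} (v : Fin (n + a) → F) : Fin n → F := fun i => v (Fin.castAdd a i)

theorem inp_append {n a : ℕ} (y : Fin n → F) (w : Fin a → F) : inp (Fin.append y w) = y := by
  funext i
  simp [inp]

theorem sum_append {M : Type*} [AddCommMonoid M] {n a : ℕ} (g : (Fin (n + a) → F) → M) :
    ∑ v, g v = ∑ y : Fin n → F, ∑ w : Fin a → F, g (Fin.append y w) := by
  rw [← Fintype.sum_prod_type']
  exact ((Fin.appendEquiv n a).sum_comp g).symm

theorem noisyState_apply {n : ℕ} (f : (Fin n → F) → ℂ) (c x : Fin n → F) :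
    noisyState f c x = f (x - c) := by
  rw [noisyState, Finset.sum_apply, Finset.sum_eq_single (x - c)]
  · simp [ket]
  · intro e _ he
    have : x ≠ c + e := by
      rintro rfl
      exact he (by simp)
    simp [ket, this]
  · simp

theorem sum_norm_sq_noisyState {n : ℕ} {f : (Fin n → F) → ℂ} (hf : ∑ e, ‖f e‖ ^ 2 = 1)
    (c : Fin n → F) : ∑ x, ‖noisyState f c x‖ ^ 2 = 1 := by
  simp only [noisyState_apply]
  rw [← hf]
  exact (Equiv.subRight c).sum_comp fun e => ‖f e‖ ^ 2

theorem withAncilla_append {n a : ℕ} (ψ : State F n) (y : Fin n → F) (w : Fin a → F) :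
    withAncilla a ψ (Fin.append y w) = if w = 0 then ψ y else 0 := by
  simp [withAncilla, funext_iff]

theorem sum_norm_sq_withAncilla {n : ℕ} (a : ℕ) (ψ : State F n) :
    ∑ v, ‖withAncilla a ψ v‖ ^ 2 = ∑ x, ‖ψ x‖ ^ 2 := by
  rw [sum_append]
  refine Finset.sum_congr rfl fun y _ => ?_
  rw [Finset.sum_eq_single 0]
  · simp [withAncilla_append]
  · intro w _ hw
    simp [withAncilla_append, hw]
  · simp

variable {n K : ℕ}

/-- The final state of the circuit `D` on the noisy codeword with message `a`. -/
def codeRun (D : Circuit F n) (f : (Fin n → F) → ℂ) (E : Matrix (Fin n) (Fin K) F)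
    (a : Fin K → F) : State F (n + D.anc) := D.run (noisyState f (E *ᵥ a))

/-- The probability that applying `L` to the output of `D` gives the message. -/
def decodeProb (D : Circuit F n) (f : (Fin n → F) → ℂ) (E : Matrix (Fin n) (Fin K) F)
    (L : Matrix (Fin K) (Fin n) F) : ℝ :=
  (∑ v, ‖codeRun D f E (L *ᵥ inp v) v‖ ^ 2) / (Fintype.card F : ℝ) ^ K

theorem sum_norm_sq_codeRun (D : Circuit F n) {f : (Fin n → F) → ℂ} (hf : ∑ e, ‖f e‖ ^ 2 = 1)
    (E : Matrix (Fin n) (Fin K) F) (a : Fin K → F) : ∑ v, ‖codeRun D f E a v‖ ^ 2 = 1 := by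
  obtain ⟨M, hM, h⟩ := exists_impl_of_gates D.gates
  rw [codeRun, Circuit.run, h, sum_norm_sq_mulVec hM.mem_unitary, sum_norm_sq_withAncilla,
    sum_norm_sq_noisyState hf]

theorem decodeProb_le_one (D : Circuit F n) {f : (Fin n → F) → ℂ} (hf : ∑ e, ‖f e‖ ^ 2 = 1)
    (E : Matrix (Fin n) (Fin K) F) (L : Matrix (Fin K) (Fin n) F) : decodeProb D f E L ≤ 1 := by
  have hq : (0 : ℝ) < Fintype.card F := by exact_mod_cast Fintype.card_pos
  rw [decodeProb, div_le_one (by positivity)]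
  calc ∑ v, ‖codeRun D f E (L *ᵥ inp v) v‖ ^ 2
      ≤ ∑ v, ∑ a, ‖codeRun D f E a v‖ ^ 2 :=
        Finset.sum_le_sum fun v _ => Finset.single_le_sum
          (f := fun a => ‖codeRun D f E a v‖ ^ 2) (fun a _ => by positivity)
          (Finset.mem_univ (L *ᵥ inp v))
    _ = (Fintype.card F : ℝ) ^ K := by
        rw [Finset.sum_comm, Finset.sum_congr rfl fun a _ => sum_norm_sq_codeRun D hf E a]
        simp

/-- When the decoder outputs the right codeword, `L` recovers the message. The right-hand side also
counts outputs that are not codewords but which `L` sends to the message. -/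
theorem qdpSuccess_le_decodeProb {α : Fin n → F} (hα : Function.Injective α) (hK : K ≤ n)
    (D : Circuit F n) (f : (Fin n → F) → ℂ) {L : Matrix (Fin K) (Fin n) F}
    (hL : ∀ a, L *ᵥ (enc α K *ᵥ a) = a) :
    qdpSuccess (reedSolomon α K) f D ≤ decodeProb D f (enc α K) L := by
  classical
  let e : (Fin K → F) ≃ reedSolomon α K := Equiv.ofBijective
    (fun a => ⟨enc α K *ᵥ a, (mem_reedSolomon_iff α K _).2 ⟨a, rfl⟩⟩)
    ⟨fun a b h => enc_injective hα hK (congrArg Subtype.val h),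
      fun c => by
        obtain ⟨a, ha⟩ := (mem_reedSolomon_iff α K _).1 c.2
        exact ⟨a, Subtype.ext ha⟩⟩
  have hq : (0 : ℝ) < Fintype.card F := by exact_mod_cast Fintype.card_pos
  rw [qdpSuccess, decodeProb]
  have hcard : (Nat.card (reedSolomon α K) : ℝ) = (Fintype.card F : ℝ) ^ K := by
    rw [← Nat.card_congr e]
    simp
  rw [hcard]
  refine div_le_div_of_nonneg_right ?_ (by positivity)
  rw [sum_append, ← e.sum_comp]
  have hsum : ∑ a : Fin K → F, ∑ w : Fin D.anc → F,
      ‖codeRun D f (enc α K) (L *ᵥ inp (Fin.append (enc α K *ᵥ a) w))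
        (Fin.append (enc α K *ᵥ a) w)‖ ^ 2 ≤
      ∑ y : Fin n → F, ∑ w : Fin D.anc → F,
        ‖codeRun D f (enc α K) (L *ᵥ inp (Fin.append y w)) (Fin.append y w)‖ ^ 2 := by
    rw [← Finset.sum_image (g := fun a : Fin K → F => enc α K *ᵥ a) (f := fun y =>
      ∑ w : Fin D.anc → F,
        ‖codeRun D f (enc α K) (L *ᵥ inp (Fin.append y w)) (Fin.append y w)‖ ^ 2)
      (fun a _ b _ h => enc_injective hα hK h)]
    exact Finset.sum_le_univ_sum_of_nonneg fun y => Finset.sum_nonneg fun w _ => by positivity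
  refine le_trans (le_of_eq ?_) hsum
  refine Finset.sum_congr rfl fun a _ => Finset.sum_congr rfl fun w _ => ?_
  rw [inp_append, hL]
  rfl

/-! ### The Fourier transform of the superposition of noisy codewords -/

/-- The Fourier transform of the first `n` of `n + a` qudits. -/
def dftInp (χ : AddChar F ℂ) (n a : ℕ) : Fin (n + a) → Matrix F F ℂ :=
  Fin.addCases (fun _ => (dft χ)ᴴ) fun _ => 1

theorem dftInp_mem_unitary {χ : AddChar F ℂ} (hχ : χ.IsPrimitive) (n a : ℕ) (i : Fin (n + a)) :
    dftInp χ n a i ∈ unitaryGroup F ℂ := by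
  refine Fin.addCases (fun i => ?_) (fun i => ?_) i
  · rw [dftInp, Fin.addCases_left, ← star_eq_conjTranspose]
    exact Unitary.star_mem (dft_mem_unitary hχ)
  · rw [dftInp, Fin.addCases_right]
    exact one_mem _

theorem dft_conjTranspose_mulVec_shift (χ : AddChar F ℂ) (u : F → ℂ) (c x : F) :
    ((dft χ)ᴴ *ᵥ fun a => u (a - c)) x = χ (-(c * x)) * ((dft χ)ᴴ *ᵥ u) x := by
  simp only [mulVec, dotProduct, Finset.mul_sum]
  rw [← Equiv.sum_comp (Equiv.addRight c)]
  refine Finset.sum_congr rfl fun a _ => ?_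
  simp only [Equiv.coe_addRight, add_sub_cancel_right, conjTranspose_apply, dft, star_div₀,
    Complex.star_def, ← AddChar.map_neg_eq_conj]
  rw [add_mul, neg_add, AddChar.map_add_eq_mul]
  ring

theorem dftInp_mulVec_withAncilla (χ : AddChar F ℂ) (a : ℕ) (u : F → ℂ) (c : Fin n → F)
    (v : Fin (n + a) → F) :
    (tensor (dftInp χ n a) *ᵥ withAncilla a (noisyState (prodAmp u) c)) v =
      if ∀ j : Fin a, v (Fin.natAdd n j) = 0 then
        χ (-(c ⬝ᵥ inp v)) * ∏ i, ((dft χ)ᴴ *ᵥ u) (inp v i) else 0 := by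
  let g : Fin (n + a) → F → ℂ :=
    Fin.addCases (fun i b => u (b - c i)) fun _ b => if b = 0 then 1 else 0
  have hprod : withAncilla a (noisyState (prodAmp u) c) = fun e => ∏ i, g i (e i) := by
    funext e
    rw [Fin.prod_univ_add, withAncilla]
    simp only [g, Fin.addCases_left, Fin.addCases_right, Finset.prod_ite_zero,
      Finset.prod_const_one, noisyState_apply, prodAmp, Finset.mem_univ, forall_true_left,
      Pi.sub_apply, mul_ite, mul_one, mul_zero]
  rw [hprod, tensor_mulVec_prod, Fin.prod_univ_add]
  simp only [g, dftInp, Fin.addCases_left, Fin.addCases_right, one_mulVec, Finset.prod_ite_zero,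
    Finset.prod_const_one, Finset.mem_univ, forall_true_left, dft_conjTranspose_mulVec_shift,
    mul_ite, mul_one, mul_zero, Finset.prod_mul_distrib]
  rw [← addChar_sum_apply, Finset.sum_neg_distrib]
  rfl

/-- Split the overlap of `φ` and `ξ` into good and bad indices. Cauchy-Schwarz on each part gives
`√p ≤ √(S / N) + √η`, and squaring gives the bound since `√p ≤ 1`. Only the bad mass of the ideal
vector `φ` has to be controlled. -/
theorem sub_two_mul_sqrt_le {I : Type*} [Fintype I] [DecidableEq I] {φ ξ : I → ℂ} {good : I → Prop}
    [DecidablePred good] {N η p : ℝ} (hN : 0 < N) (hp : 0 ≤ p) (hp1 : p ≤ 1)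
    (hφ : ∑ i, ‖φ i‖ ^ 2 = N) (hξ : ∑ i, ‖ξ i‖ ^ 2 = N)
    (hbad : ∑ i, (if good i then 0 else ‖φ i‖ ^ 2) ≤ N * η)
    (hin : star φ ⬝ᵥ ξ = ((N * √p : ℝ) : ℂ)) :
    p - 2 * √η ≤ (∑ i, if good i then ‖ξ i‖ ^ 2 else 0) / N := by
  set S := ∑ i, if good i then ‖ξ i‖ ^ 2 else 0 with hS
  have hS0 : 0 ≤ S := Finset.sum_nonneg fun i _ => by split_ifs <;> positivity
  have hsplit : star φ ⬝ᵥ ξ = star φ ⬝ᵥ (fun i => if good i then ξ i else 0) +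
      star (fun i => if good i then 0 else φ i) ⬝ᵥ ξ := by
    simp only [dotProduct, ← Finset.sum_add_distrib]
    refine Finset.sum_congr rfl fun i _ => ?_
    by_cases h : good i <;> simp [h]
  have hle : N * √p ≤ √N * √S + √(N * η) * √N := by
    have h1 := norm_star_dotProduct_le φ fun i => if good i then ξ i else 0
    have h2 := norm_star_dotProduct_le (fun i => if good i then 0 else φ i) ξ
    have e1 : ∑ i, ‖if good i then ξ i else 0‖ ^ 2 = S :=
      Finset.sum_congr rfl fun i _ => by split_ifs <;> simp
    have e2 : ∑ i, ‖if good i then 0 else φ i‖ ^ 2 ≤ N * η :=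
      le_trans (le_of_eq (Finset.sum_congr rfl fun i _ => by split_ifs <;> simp)) hbad
    rw [hφ, e1] at h1
    rw [hξ] at h2
    have h3 : ‖star φ ⬝ᵥ ξ‖ = N * √p := by
      rw [hin, Complex.norm_real, Real.norm_of_nonneg (by positivity)]
    rw [← h3, hsplit]
    refine (norm_add_le _ _).trans (add_le_add h1 (h2.trans ?_))
    gcongr
  have hmain : √p ≤ √(S / N) + √η := by
    rw [Real.sqrt_mul hN.le, mul_right_comm, Real.mul_self_sqrt hN.le] at hle
    have hNs : N = √N * √N := (Real.mul_self_sqrt hN.le).symm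
    have hs : √S = √N * √(S / N) := by
      rw [← Real.sqrt_mul hN.le]
      congr 1
      field_simp
    rw [hs, ← mul_assoc, ← hNs, ← mul_add] at hle
    exact le_of_mul_le_mul_left hle hN
  have hsp : √p * √p = p := Real.mul_self_sqrt hp
  have hsp1 : √p ≤ 1 := Real.sqrt_le_one.2 hp1
  have hsp0 := Real.sqrt_nonneg p
  have hsη := Real.sqrt_nonneg η
  have hx : √(S / N) * √(S / N) = S / N := Real.mul_self_sqrt (by positivity)
  have hx0 := Real.sqrt_nonneg (S / N)
  rw [← hx, ← hsp]
  -- If `√p ≤ √η` the left side is at most zero; otherwise `√p - √η` is nonnegative and may be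
  -- squared.
  by_cases h : √p ≤ √η
  · nlinarith
  · nlinarith [mul_self_le_mul_self (by linarith : 0 ≤ √p - √η) (by linarith : √p - √η ≤ √(S / N))]

end Decoder

/-! ### Decoding in the dual code by Fourier transform -/

section Estimate

variable {F : Type*} [Field F] [Fintype F] [DecidableEq F] {n K : ℕ}

/-- The normalised part of the superposition of decoded noisy codewords on which the message
register has been erased. -/
def decodedState (χ : AddChar F ℂ) (D : Circuit F n) (f : (Fin n → F) → ℂ)
    (E : Matrix (Fin n) (Fin K) F) (L : Matrix (Fin K) (Fin n) F) (y : Fin n → F) :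
    State F (n + D.anc) := fun v =>
  χ ((L *ᵥ inp v) ⬝ᵥ (y ᵥ* E)) * codeRun D f E (L *ᵥ inp v) v /
    (√((Fintype.card F : ℝ) ^ K) * √(decodeProb D f E L) : ℝ)

/-- The superposition of noisy codewords with phases given by `y`. -/
def phasedState (χ : AddChar F ℂ) (a : ℕ) (f : (Fin n → F) → ℂ)
    (E : Matrix (Fin n) (Fin K) F) (y : Fin n → F) : State F (n + a) := fun v =>
  (∑ m : Fin K → F, χ (m ⬝ᵥ (y ᵥ* E)) * withAncilla a (noisyState f (E *ᵥ m)) v) /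
    (√((Fintype.card F : ℝ) ^ K) : ℝ)

/-- The input `y` enters only through phases of modulus one, so one normalisation serves all inputs.
This is why a single fixed rotation makes amplification exact for every `y`. -/
theorem sum_norm_sq_decodedState (χ : AddChar F ℂ) (D : Circuit F n) (f : (Fin n → F) → ℂ)
    (E : Matrix (Fin n) (Fin K) F) (L : Matrix (Fin K) (Fin n) F)
    (hp : 0 < decodeProb D f E L) (y : Fin n → F) :
    ∑ v, ‖decodedState χ D f E L y v‖ ^ 2 = 1 := by
  have hq : (0 : ℝ) < Fintype.card F := by exact_mod_cast Fintype.card_pos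
  simp only [decodedState, norm_div, norm_mul, AddChar.norm_apply, one_mul, Complex.norm_real, div_pow,
    Real.norm_eq_abs, sq_abs, mul_pow, Real.sq_sqrt hp.le]
  rw [Real.sq_sqrt (by positivity), ← Finset.sum_div, div_eq_one_iff_eq (by positivity),
    decodeProb, mul_div_cancel₀ _ (by positivity)]

theorem sum_addChar_vecMul {χ : AddChar F ℂ} (hχ : χ.IsPrimitive)
    {E : Matrix (Fin n) (Fin K) F} (hE : Function.Injective fun a => E *ᵥ a) (a : Fin K → F) :
    ∑ y : Fin n → F, χ (a ⬝ᵥ (y ᵥ* E)) =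
      if a = 0 then (Fintype.card F : ℂ) ^ n else 0 := by
  have h (y : Fin n → F) : a ⬝ᵥ (y ᵥ* E) = (E *ᵥ a) ⬝ᵥ y := by
    rw [dotProduct_comm, ← dotProduct_mulVec, dotProduct_comm]
  have h0 : E *ᵥ a = 0 ↔ a = 0 :=
    ⟨fun e => hE (by simpa using e), fun e => by simp [e]⟩
  simp only [h, sum_addChar_dotProduct hχ, h0, Fintype.card_fin]

/-- Summing over `y` annihilates every pair of distinct messages. What survives in the overlap is
the message read off by `L`, contributing the decoding mass `p` divided by the normalisation `√p`.
For a single `y` the overlap need not be `√p`. -/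
theorem inner_phasedState_decodedState {χ : AddChar F ℂ} (hχ : χ.IsPrimitive) (D : Circuit F n)
    (f : (Fin n → F) → ℂ) {E : Matrix (Fin n) (Fin K) F}
    (hE : Function.Injective fun a => E *ᵥ a) (L : Matrix (Fin K) (Fin n) F)
    (hp : 0 < decodeProb D f E L)
    {M : Matrix (Fin (n + D.anc) → F) (Fin (n + D.anc) → F) ℂ}
    (hM : ∀ ψ, D.gates.foldl (fun φ g => g.apply φ) ψ = M *ᵥ ψ) :
    ∑ y, star (M *ᵥ phasedState χ D.anc f E y) ⬝ᵥ decodedState χ D f E L y =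
      (((Fintype.card F : ℝ) ^ n * √(decodeProb D f E L) : ℝ) : ℂ) := by
  have hq : (0 : ℝ) < Fintype.card F := by exact_mod_cast Fintype.card_pos
  set Q : ℝ := √((Fintype.card F : ℝ) ^ K) with hQ
  have hQ2 : Q * Q = (Fintype.card F : ℝ) ^ K := Real.mul_self_sqrt (by positivity)
  have hQ0 : 0 < Q := Real.sqrt_pos.2 (by positivity)
  set p := decodeProb D f E L with hpdef
  have hM' (y : Fin n → F) : M *ᵥ phasedState χ D.anc f E y = fun v =>
      (∑ m, χ (m ⬝ᵥ (y ᵥ* E)) * codeRun D f E m v) / (Q : ℂ) := by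
    have : phasedState χ D.anc f E y = (Q : ℂ)⁻¹ • ∑ m : Fin K → F,
        χ (m ⬝ᵥ (y ᵥ* E)) • withAncilla D.anc (noisyState f (E *ᵥ m)) := by
      funext v
      simp [phasedState, div_eq_inv_mul, hQ]
    rw [this, mulVec_smul, mulVec_sum]
    funext v
    simp [mulVec_smul, codeRun, Circuit.run, hM, div_eq_inv_mul]
  have hpt (v : Fin (n + D.anc) → F) :
      ∑ y, star ((M *ᵥ phasedState χ D.anc f E y) v) * decodedState χ D f E L y v =
      (((Fintype.card F : ℝ) ^ n / (Q * Q * √p) *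
        ‖codeRun D f E (L *ᵥ inp v) v‖ ^ 2 : ℝ) : ℂ) := by
    have hterm (y : Fin n → F) :
        star ((M *ᵥ phasedState χ D.anc f E y) v) * decodedState χ D f E L y v =
        ∑ m, χ ((L *ᵥ inp v - m) ⬝ᵥ (y ᵥ* E)) * (star (codeRun D f E m v) *
          codeRun D f E (L *ᵥ inp v) v / (Q * Q * √p : ℝ)) := by
      rw [hM', decodedState, star_div₀, star_sum, Complex.star_def, Complex.conj_ofReal,
        Finset.sum_div, Finset.sum_mul]
      refine Finset.sum_congr rfl fun m _ => ?_
      rw [map_mul, ← AddChar.map_neg_eq_conj, sub_dotProduct,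
        sub_eq_add_neg, AddChar.map_add_eq_mul]
      push_cast
      ring
    rw [Finset.sum_congr rfl fun y _ => hterm y, Finset.sum_comm]
    simp only [← Finset.sum_mul, sum_addChar_vecMul hχ hE, sub_eq_zero, ite_mul, zero_mul,
      Finset.sum_ite_eq, Finset.mem_univ, if_true]
    rw [Complex.star_def, Complex.conj_mul']
    push_cast
    ring
  simp only [dotProduct, Pi.star_apply]
  rw [Finset.sum_comm, Finset.sum_congr rfl fun v _ => hpt v, ← Complex.ofReal_sum,
    ← Finset.mul_sum]
  congr 1
  have hs : ∑ v, ‖codeRun D f E (L *ᵥ inp v) v‖ ^ 2 = Q * Q * p := by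
    rw [hQ2, hpdef, decodeProb, mul_div_cancel₀ _ (by positivity)]
  rw [hs]
  have hsp : p = √p * √p := (Real.mul_self_sqrt hp.le).symm
  have hsp0 : 0 < √p := Real.sqrt_pos.2 hp
  nth_rewrite 2 [hsp]
  field_simp

/-- Shifting the noise by a codeword becomes a phase under the transform. The sum over messages is
then a complete character sum in `(y - inp v) ᵥ* E`: it is `q ^ K` or zero, and squaring against the
normalisation leaves a factor `q ^ K`. -/
theorem norm_sq_dft_phasedState {χ : AddChar F ℂ} (hχ : χ.IsPrimitive) (a : ℕ) (u : F → ℂ)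
    (E : Matrix (Fin n) (Fin K) F) (y : Fin n → F) (v : Fin (n + a) → F) :
    ‖(tensor (dftInp χ n a) *ᵥ phasedState χ a (prodAmp u) E y) v‖ ^ 2 =
      if (∀ j : Fin a, v (Fin.natAdd n j) = 0) ∧ (y - inp v) ᵥ* E = 0 then
        (Fintype.card F : ℝ) ^ K * ∏ i, ‖((dft χ)ᴴ *ᵥ u) (inp v i)‖ ^ 2 else 0 := by
  have hq : (0 : ℝ) < Fintype.card F := by exact_mod_cast Fintype.card_pos
  set Q : ℝ := √((Fintype.card F : ℝ) ^ K) with hQ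
  have hQ2 : Q ^ 2 = (Fintype.card F : ℝ) ^ K := Real.sq_sqrt (by positivity)
  have h : (tensor (dftInp χ n a) *ᵥ phasedState χ a (prodAmp u) E y) v =
      (∑ m, χ (m ⬝ᵥ (y ᵥ* E)) *
        (tensor (dftInp χ n a) *ᵥ withAncilla a (noisyState (prodAmp u) (E *ᵥ m))) v) /
          (Q : ℂ) := by
    have : phasedState χ a (prodAmp u) E y = (Q : ℂ)⁻¹ • ∑ m : Fin K → F,
        χ (m ⬝ᵥ (y ᵥ* E)) • withAncilla a (noisyState (prodAmp u) (E *ᵥ m)) := by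
      funext v
      simp [phasedState, div_eq_inv_mul, hQ]
    rw [this, mulVec_smul, mulVec_sum]
    simp [mulVec_smul, div_eq_inv_mul]
  rw [h]
  simp only [dftInp_mulVec_withAncilla]
  by_cases hv : ∀ j : Fin a, v (Fin.natAdd n j) = 0
  · have hterm (m : Fin K → F) : χ (m ⬝ᵥ (y ᵥ* E)) * (χ (-((E *ᵥ m) ⬝ᵥ inp v)) *
        ∏ i, ((dft χ)ᴴ *ᵥ u) (inp v i)) =
        χ (((y - inp v) ᵥ* E) ⬝ᵥ m) * ∏ i, ((dft χ)ᴴ *ᵥ u) (inp v i) := by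
      rw [← mul_assoc, ← AddChar.map_add_eq_mul, sub_vecMul, sub_dotProduct, sub_eq_add_neg,
        dotProduct_comm m, dotProduct_comm (E *ᵥ m), dotProduct_mulVec]
    simp only [if_pos hv, hterm, ← Finset.sum_mul, sum_addChar_dotProduct hχ, Fintype.card_fin]
    by_cases hw : (y - inp v) ᵥ* E = 0
    · rw [if_pos hw, if_pos ⟨hv, hw⟩, norm_div, norm_mul, div_pow, mul_pow, norm_pow,
        Complex.norm_natCast, Complex.norm_real, Real.norm_eq_abs, sq_abs, hQ2, norm_prod,
        Finset.prod_pow]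
      field_simp
    · rw [if_neg hw, if_neg (fun h => hw h.2)]
      simp
  · rw [if_neg (fun h => hv h.1)]
    simp [hv]

/-- The phased states are not normalised individually; only their total over `y` is a product
distribution in `inp v`. -/
theorem sum_norm_sq_dft_phasedState {χ : AddChar F ℂ} (hχ : χ.IsPrimitive) (a : ℕ) (u : F → ℂ)
    {E : Matrix (Fin n) (Fin K) F} (hE : Function.Injective fun a => E *ᵥ a)
    (v : Fin (n + a) → F) :
    ∑ y, ‖(tensor (dftInp χ n a) *ᵥ phasedState χ a (prodAmp u) E y) v‖ ^ 2 =
      if ∀ j : Fin a, v (Fin.natAdd n j) = 0 then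
        (Fintype.card F : ℝ) ^ n * ∏ i, ‖((dft χ)ᴴ *ᵥ u) (inp v i)‖ ^ 2 else 0 := by
  simp only [norm_sq_dft_phasedState hχ]
  by_cases hv : ∀ j : Fin a, v (Fin.natAdd n j) = 0
  · simp only [hv, implies_true, true_and, if_true]
    -- The number of `y` in the coset, times `q ^ K`, is found by evaluating one double character
    -- sum in both orders.
    have hcount : ∑ y : Fin n → F, (if (y - inp v) ᵥ* E = 0 then (Fintype.card F : ℝ) ^ K else 0) =
        (Fintype.card F : ℝ) ^ n := by
      have h1 : ∑ y : Fin n → F, ∑ m : Fin K → F, χ (((y - inp v) ᵥ* E) ⬝ᵥ m) =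
          (Fintype.card F : ℂ) ^ n := by
        rw [Finset.sum_comm]
        have (m : Fin K → F) : ∑ y : Fin n → F, χ (((y - inp v) ᵥ* E) ⬝ᵥ m) =
            if m = 0 then (Fintype.card F : ℂ) ^ n else 0 := by
          rw [← sum_addChar_vecMul hχ hE m,
            ← Equiv.sum_comp (Equiv.subRight (inp v)) fun y => χ (m ⬝ᵥ (y ᵥ* E))]
          simp only [Equiv.subRight_apply, dotProduct_comm m]
        simp [this]
      simp only [sum_addChar_dotProduct hχ, Fintype.card_fin] at h1
      exact_mod_cast h1
    rw [← hcount, Finset.sum_mul]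
    simp only [ite_mul, zero_mul]
  · simp [hv]

/-- Real and ideal states for all inputs are treated as two vectors indexed by pairs `(y, v)`, each
of squared norm `q ^ q`. The unitaries `M` and `R` do not affect the overlap. -/
theorem decodeProb_sub_le {q : ℕ} (hq : Fintype.card F = q) (α : Fin q ≃ F) {k : ℕ} (hk : 1 ≤ k)
    {τ : ℝ} (h0 : 0 < τ) (h1 : τ < 1 - 1 / (q : ℝ))
    (hμ : 1 ≤ tauPerp q τ * q) (D : Circuit F q) {L : Matrix (Fin (q - k)) (Fin q) F}
    {χ : AddChar F ℂ} (hχ : χ.IsPrimitive)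
    (hf : ∑ e : Fin q → F, ‖prodAmp (bernoulliAmp F τ) e‖ ^ 2 = 1)
    (hp : 0 < decodeProb D (prodAmp (bernoulliAmp F τ)) (enc α (q - k)) L)
    {M : Matrix (Fin (q + D.anc) → F) (Fin (q + D.anc) → F) ℂ}
    (hMU : M ∈ unitaryGroup (Fin (q + D.anc) → F) ℂ)
    (hM : ∀ ψ, D.gates.foldl (fun φ g => g.apply φ) ψ = M *ᵥ ψ)
    (good : (Fin q → F) → (Fin q → F) → Prop) [∀ y x, Decidable (good y x)]
    (hgood : ∀ y x, y - x ∈ reedSolomon α k → (hammingNorm x : ℝ) ≤ tauPrime q τ * q →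
      good y x) :
    decodeProb D (prodAmp (bernoulliAmp F τ)) (enc α (q - k)) L -
        3 * Real.exp (-((tauPerp q τ * q) ^ (1 / 3 : ℝ)) / 6) ≤
      (∑ y, ∑ v, if good y (inp v) then
        ‖(tensor (dftInp χ q D.anc) *ᵥ (Mᴴ *ᵥ decodedState χ D (prodAmp (bernoulliAmp F τ))
          (enc α (q - k)) L y)) v‖ ^ 2 else 0) / (q : ℝ) ^ q := by
  set u := bernoulliAmp F τ with hu
  set E := enc α (q - k) with hEdef
  set p := decodeProb D (prodAmp u) E L with hpdef
  have hE : Function.Injective fun a => E *ᵥ a := enc_injective α.injective (Nat.sub_le q k)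
  have hqF : (0 : ℝ) < Fintype.card F := by exact_mod_cast Fintype.card_pos
  have hqpos : (0 : ℝ) < q := by rw [← hq]; exact hqF
  have hR := tensor_mem_unitary (dftInp_mem_unitary hχ q D.anc)
  have hMH : Mᴴ ∈ unitaryGroup (Fin (q + D.anc) → F) ℂ := by
    rw [← star_eq_conjTranspose]
    exact Unitary.star_mem hMU
  set R := tensor (dftInp χ q D.anc) with hRdef
  let φ : (Fin q → F) × (Fin (q + D.anc) → F) → ℂ := fun i =>
    (R *ᵥ phasedState χ D.anc (prodAmp u) E i.1) i.2
  let ξ : (Fin q → F) × (Fin (q + D.anc) → F) → ℂ := fun i =>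
    (R *ᵥ (Mᴴ *ᵥ decodedState χ D (prodAmp u) E L i.1)) i.2
  have hξ : ∑ i, ‖ξ i‖ ^ 2 = (q : ℝ) ^ q := by
    simp only [Fintype.sum_prod_type, ξ, sum_norm_sq_mulVec hR, sum_norm_sq_mulVec hMH,
      sum_norm_sq_decodedState χ D _ E L hp]
    simp [hq]
  have hin : star φ ⬝ᵥ ξ = (((q : ℝ) ^ q * √p : ℝ) : ℂ) := by
    have h := inner_phasedState_decodedState hχ D (prodAmp u) hE L hp hM
    have hqR : (Fintype.card F : ℝ) = q := by rw [hq]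
    rw [hqR] at h
    rw [← h, dotProduct, Fintype.sum_prod_type]
    refine Finset.sum_congr rfl fun y _ => ?_
    have := star_mulVec_dotProduct_mulVec hR (phasedState χ D.anc (prodAmp u) E y)
      (Mᴴ *ᵥ decodedState χ D (prodAmp u) E L y)
    refine Eq.trans this ?_
    rw [← star_mulVec_dotProduct_mulVec hMU, mulVec_mulVec, ← star_eq_conjTranspose M,
      mem_unitaryGroup_iff.1 hMU, one_mulVec]
  let w : F → ℝ := fun a => ‖((dft χ)ᴴ *ᵥ u) a‖ ^ 2
  have hw1 : ∑ x : Fin q → F, ∏ i, w (x i) = 1 := by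
    have h2 := Finset.prod_univ_sum (fun _ : Fin q => (Finset.univ : Finset F)) fun _ a => w a
    have h3 := Finset.prod_univ_sum (fun _ : Fin q => (Finset.univ : Finset F))
      fun _ a => ‖u a‖ ^ 2
    rw [Fintype.piFinset_univ] at h2 h3
    have hHU : (dft χ)ᴴ ∈ unitaryGroup F ℂ := by
      rw [← star_eq_conjTranspose]
      exact Unitary.star_mem (dft_mem_unitary hχ)
    rw [← h2]
    simp only [w, sum_norm_sq_mulVec hHU]
    rw [h3, ← hf]
    simp only [prodAmp, norm_prod, Finset.prod_pow]
  -- Used twice: with `c` always false for the total mass, and with `c` the weight bound for the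
  -- Chernoff tail.
  have hsum (c : (Fin q → F) → Prop) [DecidablePred c] :
      ∑ i, (if c (inp i.2) then 0 else ‖φ i‖ ^ 2) =
      (q : ℝ) ^ q * ∑ x : Fin q → F, if c x then 0 else ∏ i, w (x i) := by
    rw [Fintype.sum_prod_type, Finset.sum_comm]
    have hv (v : Fin (q + D.anc) → F) :
        ∑ y, (if c (inp v) then 0 else ‖φ (y, v)‖ ^ 2) =
        if c (inp v) then 0 else if ∀ j : Fin D.anc, v (Fin.natAdd q j) = 0 then
          (q : ℝ) ^ q * ∏ i, w (inp v i) else 0 := by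
      by_cases hc : c (inp v)
      · simp [hc]
      · simp only [if_neg hc, φ]
        rw [sum_norm_sq_dft_phasedState hχ D.anc u hE v, hq]
    rw [Finset.sum_congr rfl fun v _ => hv v, sum_append, Finset.mul_sum]
    refine Finset.sum_congr rfl fun x _ => ?_
    rw [Finset.sum_eq_single 0]
    · simp [inp_append]
    · intro z _ hz
      simp only [Fin.append_right, inp_append]
      rw [if_neg (c := ∀ j, z j = 0) (fun h => hz (funext h)), ite_self]
    · simp
  have hφ : ∑ i, ‖φ i‖ ^ 2 = (q : ℝ) ^ q := by
    have := hsum fun _ => False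
    simpa [hw1] using this
  set η : ℝ := ∑ x : Fin q → F,
    if (hammingNorm x : ℝ) ≤ tauPrime q τ * q then 0 else ∏ i, w (x i) with hη
  have hbad : ∑ i, (if good i.1 (inp i.2) then 0 else ‖φ i‖ ^ 2) ≤ (q : ℝ) ^ q * η := by
    rw [hη, ← hsum fun x => (hammingNorm x : ℝ) ≤ tauPrime q τ * q]
    refine Finset.sum_le_sum fun i _ => ?_
    by_cases hg : good i.1 (inp i.2)
    · rw [if_pos hg]
      split_ifs <;> positivity
    · rw [if_neg hg]
      by_cases hn : (hammingNorm (inp i.2) : ℝ) ≤ tauPrime q τ * q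
      · rw [if_pos hn]
        refine le_of_eq ?_
        simp only [φ]
        -- A low-weight outcome can fail to be good only outside the dual coset, where the ideal
        -- amplitude vanishes.
        rw [norm_sq_dft_phasedState hχ, if_neg]
        rintro ⟨-, h⟩
        exact hg (hgood _ _ (mem_reedSolomon_of_orthogonal hq α hk _ h) hn)
      · rw [if_neg hn]
  have hkey := sub_two_mul_sqrt_le (by positivity) hp.le (decodeProb_le_one D hf E L)
    hφ hξ hbad hin
  have hη1 : √η ≤ Real.exp (-((tauPerp q τ * q) ^ (1 / 3 : ℝ)) / 6) := by
    have hw (a : F) : w a = if a = 0 then 1 - tauPerp q τ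
        else tauPerp q τ / ((Fintype.card F : ℝ) - 1) := by
      have h1' : τ < 1 - 1 / (Fintype.card F : ℝ) := by rw [hq]; exact h1
      have := norm_sq_dft_bernoulliAmp hχ h0 h1' a
      rw [← hu] at this
      simp only [w, this, hq]
    have hp0 : 0 ≤ tauPerp q τ := by rw [tauPerp]; positivity
    have hp1 : tauPerp q τ ≤ 1 := by
      have : 0 ≤ w 0 := by positivity
      rw [hw, if_pos rfl] at this
      linarith
    have hch := chernoff (F := F) (n := q) hp0 hp1 rfl hμ
    have hη' : η ≤ Real.exp (-((tauPerp q τ * q) ^ (1 / 3 : ℝ)) / 3) := by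
      refine le_trans (le_of_eq ?_) hch
      rw [hη]
      have e : tauPrime q τ * q =
          tauPerp q τ * q * (1 + (tauPerp q τ * q) ^ (-(1 / 3 : ℝ))) := by
        rw [tauPrime]
        ring
      simp only [hw, e]
    refine (Real.sqrt_le_sqrt hη').trans (le_of_eq ?_)
    rw [Real.sqrt_eq_iff_mul_self_eq (by positivity) (by positivity), ← Real.exp_add]
    congr 1
    ring
  -- The argument loses only twice the exponential; its positivity gives the stated factor `3`.
  have hpos := Real.exp_pos (-((tauPerp q τ * q) ^ (1 / 3 : ℝ)) / 6)
  rw [Fintype.sum_prod_type] at hkey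
  refine le_trans ?_ hkey
  linarith

end Estimate

/-! ### Registers with an input label and work wires -/

section Acts

variable {F : Type*} [Field F] [Fintype F] [DecidableEq F]
variable {Y C Fl : Type} [Fintype Y] [DecidableEq Y] [Fintype C] [DecidableEq C]
  [Fintype Fl] [DecidableEq Fl]

/-- The state `|y⟩ ⊗ φ ⊗ |0⟩`. -/
def emb (Fl : Type) [Fintype Fl] (y : Y → F) (φ : (C → F) → ℂ) : (Y ⊕ (C ⊕ Fl) → F) → ℂ :=
  fun x => if (∀ i, x (.inl i) = y i) ∧ (∀ j, x (.inr (.inr j)) = 0) then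
    φ (fun c => x (.inr (.inl c))) else 0

/-- `M` maps `|y⟩ ⊗ φ ⊗ |0⟩` to `|y⟩ ⊗ N φ ⊗ |0⟩`. -/
def Acts (y : Y → F) (M : Matrix (Y ⊕ (C ⊕ Fl) → F) (Y ⊕ (C ⊕ Fl) → F) ℂ)
    (N : Matrix (C → F) (C → F) ℂ) : Prop :=
  ∀ φ, M *ᵥ emb Fl y φ = emb Fl y (N *ᵥ φ)

variable {y : Y → F} {M M' : Matrix (Y ⊕ (C ⊕ Fl) → F) (Y ⊕ (C ⊕ Fl) → F) ℂ}
  {N N' : Matrix (C → F) (C → F) ℂ}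

/-- Since the label `y` and the clean flags are preserved, products of such operators can be
analysed on the work wires alone. -/
theorem Acts.mul (h : Acts y M N) (h' : Acts y M' N') : Acts y (M * M') (N * N') := fun φ => by
  rw [← mulVec_mulVec, h', h, mulVec_mulVec]

theorem Acts.pow (h : Acts y M N) (m : ℕ) : Acts y (M ^ m) (N ^ m) := by
  induction m with
  | zero => intro φ; simp
  | succ m ih => rw [pow_succ, pow_succ]; exact ih.mul h

theorem Acts.conjTranspose (h : Acts y M N) (hM : M ∈ unitaryGroup (Y ⊕ (C ⊕ Fl) → F) ℂ)
    (hN : N ∈ unitaryGroup (C → F) ℂ) : Acts y Mᴴ Nᴴ := fun φ => by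
  rw [mem_unitaryGroup_iff', star_eq_conjTranspose] at hM
  rw [mem_unitaryGroup_iff, star_eq_conjTranspose] at hN
  have : φ = N *ᵥ (Nᴴ *ᵥ φ) := by rw [mulVec_mulVec, hN, one_mulVec]
  nth_rewrite 1 [this]
  rw [← h, mulVec_mulVec, hM, one_mulVec]

/-- The embedding of the work wires. -/
def work (Y C Fl : Type) : C ↪ Y ⊕ (C ⊕ Fl) := Function.Embedding.inl.trans .inr

theorem extend_work (z : C → F) (x : Y ⊕ (C ⊕ Fl) → F) :
    Function.extend (work Y C Fl) z x =
      Sum.elim (fun i => x (.inl i)) (Sum.elim z fun j => x (.inr (.inr j))) := by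
  refine Eq.symm ((eq_extend_iff _ z x _).2 ⟨rfl, fun w hw => ?_⟩)
  rcases w with i | c | j
  · rfl
  · exact absurd ⟨c, rfl⟩ hw
  · rfl

theorem acts_lift (y : Y → F) (N : Matrix (C → F) (C → F) ℂ) :
    Acts y (lift (work Y C Fl) N) N := fun φ => by
  funext x
  rw [lift_mulVec]
  simp only [emb, extend_work, Sum.elim_inl, Sum.elim_inr]
  split_ifs
  · rfl
  · simp

theorem acts_diagonal {d : (Y ⊕ (C ⊕ Fl) → F) → ℂ} {d' : (C → F) → ℂ}
    (h : ∀ x, (∀ j, x (.inr (.inr j)) = 0) → d x = d' fun c => x (.inr (.inl c))) :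
    Acts y (diagonal d) (diagonal d') := fun φ => by
  funext x
  rw [mulVec_diagonal, emb, emb]
  split_ifs with hx
  · rw [h x hx.2, mulVec_diagonal]
  · simp

theorem acts_funMat {f g : (Y ⊕ (C ⊕ Fl) → F) → Y ⊕ (C ⊕ Fl) → F} {f' g' : (C → F) → C → F}
    (hfg : ∀ x, f (g x) = x) (hgf : ∀ x, g (f x) = x) (hfg' : ∀ x, f' (g' x) = x)
    (hgf' : ∀ x, g' (f' x) = x) (hY : ∀ x i, g x (.inl i) = x (.inl i))
    (hFl : ∀ x j, g x (.inr (.inr j)) = x (.inr (.inr j)))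
    (hC : ∀ x, (∀ i, x (.inl i) = y i) →
      (fun c => g x (.inr (.inl c))) = g' fun c => x (.inr (.inl c))) :
    Acts y (funMat f) (funMat f') := fun φ => by
  funext x
  rw [funMat_mulVec hfg hgf, emb, emb]
  simp only [hY, hFl]
  split_ifs with hx
  · rw [hC x hx.1, funMat_mulVec hfg' hgf']
  · rfl

end Acts

/-! ### Unitaries with a prescribed column -/

theorem exists_unitary_column {F : Type*} [Fintype F] [DecidableEq F] (z : F) (u : F → ℂ)
    (hu : ∑ a, ‖u a‖ ^ 2 = 1) : ∃ U ∈ unitaryGroup F ℂ, ∀ a, U a z = u a := by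
  let v : F → EuclideanSpace ℂ F := fun _ => WithLp.toLp 2 u
  have hv : Orthonormal ℂ (({z} : Set F).domRestrict v) := by
    refine ⟨fun i => ?_, fun i j hij => absurd (Subsingleton.elim i j) hij⟩
    rw [Set.domRestrict_apply, EuclideanSpace.norm_eq]
    exact (congrArg _ hu).trans Real.sqrt_one
  obtain ⟨b, hb⟩ := hv.exists_orthonormalBasis_extension_of_card_eq (by simp)
  refine ⟨of fun a j => b j a, ?_, fun a => ?_⟩
  · rw [mem_unitaryGroup_iff']
    ext i j
    have := orthonormal_iff_ite.1 b.orthonormal i j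
    rw [PiLp.inner_apply] at this
    simp only [RCLike.inner_apply] at this
    rw [mul_apply, one_apply, ← this]
    refine Finset.sum_congr rfl fun a _ => ?_
    rw [star_apply, Complex.star_def, of_apply, of_apply, mul_comm]
  · change b z a = u a
    rw [hb z rfl]

theorem sum_norm_sq_bernoulliAmp {F : Type*} [Field F] [Fintype F] [DecidableEq F] {τ : ℝ}
    (h0 : 0 < τ) (h1 : τ < 1 - 1 / (Fintype.card F : ℝ)) :
    ∑ a, ‖bernoulliAmp F τ a‖ ^ 2 = 1 := by
  have hq1 : (1 : ℝ) < Fintype.card F := by exact_mod_cast Fintype.one_lt_card (α := F)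
  have hτ1 : τ < 1 := h1.trans_le (by simp)
  have hq0 : (Fintype.card F : ℝ) - 1 ≠ 0 := by linarith
  rw [← Finset.add_sum_erase _ _ (Finset.mem_univ (0 : F)), Finset.sum_congr rfl
    (g := fun _ => τ / ((Fintype.card F : ℝ) - 1))]
  · rw [Finset.sum_const, Finset.card_erase_of_mem (Finset.mem_univ _), Finset.card_univ,
      nsmul_eq_mul, Nat.cast_sub Fintype.card_pos, bernoulliAmp, if_pos rfl, Complex.norm_real,
      Real.norm_eq_abs, sq_abs, Real.sq_sqrt (by linarith)]
    push_cast
    field_simp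
    ring
  · intro a ha
    rw [bernoulliAmp, if_neg (Finset.ne_of_mem_erase ha), Complex.norm_real, Real.norm_eq_abs,
      sq_abs, Real.sq_sqrt (div_nonneg h0.le (by linarith))]

theorem sum_norm_sq_prodAmp {F : Type*} [Field F] [Fintype F] [DecidableEq F] {u : F → ℂ}
    (hu : ∑ a, ‖u a‖ ^ 2 = 1) (n : ℕ) : ∑ e : Fin n → F, ‖prodAmp u e‖ ^ 2 = 1 := by
  have h := Finset.prod_univ_sum (fun _ : Fin n => (Finset.univ : Finset F)) fun _ a => ‖u a‖ ^ 2
  rw [Fintype.piFinset_univ] at h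
  simp only [prodAmp, norm_prod, ← Finset.prod_pow]
  rw [← h, hu, Finset.prod_const_one]

/-! ### The preparation unitary -/

section Preparation

variable {F : Type*} [Field F] [Fintype F] [DecidableEq F] {n K : ℕ}

/-- The work wires: message register, a rotation qudit, and the register of the decoder. -/
abbrev Wires (K N : ℕ) : Type := (Fin K ⊕ Unit) ⊕ Fin N

/-- Padding a word with zeros. -/
def pad (a : ℕ) (x : Fin n → F) : Fin (n + a) → F := Fin.addCases x fun _ => 0

theorem pad_castAdd (a : ℕ) (x : Fin n → F) (i : Fin n) : pad a x (Fin.castAdd a i) = x i := by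
  simp [pad]

theorem pad_natAdd (a : ℕ) (x : Fin n → F) (i : Fin a) : pad a x (Fin.natAdd n i) = 0 := by
  simp [pad]

/-- The matrix that adds the encoded message to the decoder register. -/
def encodeMat (a : ℕ) (E : Matrix (Fin n) (Fin K) F) : Matrix (Wires K (n + a)) (Wires K (n + a)) F :=
  fromBlocks 0 0 (fromCols (of fun i j => pad a (fun i' => E i' j) i) 0) 0

/-- The matrix that subtracts the decoded message from the message register. -/
def decodeMat (a : ℕ) (L : Matrix (Fin K) (Fin n) F) : Matrix (Wires K (n + a)) (Wires K (n + a)) F :=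
  fromBlocks 0 (fromRows (of fun j => pad a fun i => -L j i) 0) 0 0

theorem encodeMat_mulVec (a : ℕ) (E : Matrix (Fin n) (Fin K) F) (z : Wires K (n + a) → F) :
    encodeMat a E *ᵥ z =
      Sum.elim (fun _ => 0) (pad a (E *ᵥ fun j => z (.inl (.inl j)))) := by
  rw [encodeMat, fromBlocks_mulVec]
  congr 1
  · funext i
    simp
  · rw [fromCols_mulVec, zero_mulVec, zero_mulVec, add_zero, add_zero]
    funext i
    refine Fin.addCases (fun i => ?_) (fun i => ?_) i
    · simp [mulVec, dotProduct, pad_castAdd]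
    · simp [mulVec, dotProduct, pad_natAdd]

theorem decodeMat_mulVec (a : ℕ) (L : Matrix (Fin K) (Fin n) F) (z : Wires K (n + a) → F) :
    decodeMat a L *ᵥ z = Sum.elim (Sum.elim (-(L *ᵥ inp fun i => z (.inr i))) fun _ => 0) fun _ => 0 := by
  rw [decodeMat, fromBlocks_mulVec]
  congr 1
  · rw [zero_mulVec, zero_add, fromRows_mulVec, zero_mulVec]
    congr 1
    funext j
    simp only [mulVec, dotProduct, Fin.sum_univ_add, of_apply, pad_castAdd, pad_natAdd, zero_mul,
      Finset.sum_const_zero, add_zero, Pi.neg_apply, neg_mul, Finset.sum_neg_distrib]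
    rfl
  · funext i
    simp

/-- A shear whose matrix squares to zero is inverted by changing its sign. -/
theorem add_mulVec_sub {W : Type} [Fintype W] {B : Matrix W W F}
    (hB : ∀ z : W → F, B *ᵥ (B *ᵥ z) = 0) (z : W → F) :
    (z - B *ᵥ z) + B *ᵥ (z - B *ᵥ z) = z := by
  rw [mulVec_sub, hB]
  simp

theorem sub_mulVec_add {W : Type} [Fintype W] {B : Matrix W W F}
    (hB : ∀ z : W → F, B *ᵥ (B *ᵥ z) = 0) (z : W → F) :
    (z + B *ᵥ z) - B *ᵥ (z + B *ᵥ z) = z := by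
  rw [mulVec_add, hB]
  simp

theorem encodeMat_sq (a : ℕ) (E : Matrix (Fin n) (Fin K) F) (z : Wires K (n + a) → F) :
    encodeMat a E *ᵥ (encodeMat a E *ᵥ z) = 0 := by
  rw [encodeMat_mulVec a E (encodeMat a E *ᵥ z), encodeMat_mulVec]
  funext w
  rcases w with w | w
  · rfl
  · refine Fin.addCases (fun i => ?_) (fun i => ?_) w
    · simp [mulVec, dotProduct, pad_castAdd]
    · simp [pad_natAdd]

theorem decodeMat_sq (a : ℕ) (L : Matrix (Fin K) (Fin n) F) (z : Wires K (n + a) → F) :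
    decodeMat a L *ᵥ (decodeMat a L *ᵥ z) = 0 := by
  rw [decodeMat_mulVec a L (decodeMat a L *ᵥ z), decodeMat_mulVec]
  funext w
  rcases w with (w | w) | w
  · simp [mulVec, dotProduct, inp]
  · rfl
  · rfl

/-- One-qudit unitaries of the preparation. -/
def prepLocal (χ : AddChar F ℂ) (ρ π : Matrix F F ℂ) (K n a : ℕ) : Wires K (n + a) → Matrix F F ℂ :=
  Sum.elim (Sum.elim (fun _ => dft χ) fun _ => ρ) (Fin.addCases (fun _ => π) fun _ => 1)

/-- The part of the preparation that does not depend on the input. -/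
def prepMat (χ : AddChar F ℂ) (ρ π : Matrix F F ℂ) (E : Matrix (Fin n) (Fin K) F)
    (L : Matrix (Fin K) (Fin n) F) (a : ℕ)
    (M : Matrix (Fin (n + a) → F) (Fin (n + a) → F) ℂ) :
    Matrix (Wires K (n + a) → F) (Wires K (n + a) → F) ℂ :=
  funMat (fun z => z + decodeMat a L *ᵥ z) * (lift .inr M *
    (funMat (fun z => z + encodeMat a E *ᵥ z) * tensor (prepLocal χ ρ π K n a)))

theorem Impl.prepMat {χ : AddChar F ℂ} (hχ : χ.IsPrimitive) {ρ π : Matrix F F ℂ}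
    (hρ : ρ ∈ unitaryGroup F ℂ) (hπ : π ∈ unitaryGroup F ℂ) (E : Matrix (Fin n) (Fin K) F)
    (L : Matrix (Fin K) (Fin n) F) (a : ℕ) {c : ℕ}
    {M : Matrix (Fin (n + a) → F) (Fin (n + a) → F) ℂ} (hM : Impl c M) :
    Impl ((K + 1 + (n + a)) * (K + 1 + (n + a)) * Fintype.card F ^ 4 + (c +
      ((K + 1 + (n + a)) * (K + 1 + (n + a)) * Fintype.card F ^ 4 +
        (K + 1 + (n + a)) * Fintype.card F ^ 2))) (prepMat χ ρ π E L a M) := by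
  have hcard : Fintype.card (Wires K (n + a)) = K + 1 + (n + a) := by simp
  rw [← hcard]
  refine Impl.mul ?_ (Impl.mul (hM.lift _) (Impl.mul ?_ ?_))
  · refine Impl.shear (Set.range Sum.inl) _ fun t s h => ?_
    rcases t with t | t <;> rcases s with s | s
    · simp [decodeMat] at h
    · simp
    · simp [decodeMat] at h
    · simp [decodeMat] at h
  · refine Impl.shear (Set.range Sum.inr) _ fun t s h => ?_
    rcases t with t | t <;> rcases s with s | s
    · simp [encodeMat] at h
    · simp [encodeMat] at h
    · simp
    · simp [encodeMat] at h
  · refine Impl.tensor fun i => ?_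
    rcases i with (i | i) | i
    · exact dft_mem_unitary hχ
    · exact hρ
    · refine Fin.addCases (fun i => ?_) (fun i => ?_) i
      · simpa [prepLocal] using hπ
      · simp only [prepLocal, Sum.elim_inr, Fin.addCases_right]
        exact one_mem _

theorem extend_inr {C X : Type} (z : X → F) (x : C ⊕ X → F) :
    Function.extend (Function.Embedding.inr : X ↪ C ⊕ X) z x =
      Sum.elim (fun i => x (.inl i)) z := by
  refine Eq.symm ((eq_extend_iff _ z x _).2 ⟨rfl, fun w hw => ?_⟩)
  rcases w with i | j
  · rfl
  · exact absurd ⟨j, rfl⟩ hw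

theorem sqrt_pow_eq (x : ℝ) (hx : 0 ≤ x) (K : ℕ) : √(x ^ K) = √x ^ K := by
  rw [Real.sqrt_eq_iff_mul_self_eq (by positivity) (by positivity), ← mul_pow,
    Real.mul_self_sqrt hx]

/-- The amplitudes of the prepared state. -/
theorem prepMat_mulVec_single (χ : AddChar F ℂ) {ρ π : Matrix F F ℂ} {u : F → ℂ}
    (hπ : ∀ b, π b 0 = u b) (E : Matrix (Fin n) (Fin K) F) (L : Matrix (Fin K) (Fin n) F)
    (D : Circuit F n) {M : Matrix (Fin (n + D.anc) → F) (Fin (n + D.anc) → F) ℂ}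
    (hM : ∀ ψ, D.gates.foldl (fun φ g => g.apply φ) ψ = M *ᵥ ψ) (s : Fin K → F)
    (z : Wires K (n + D.anc) → F) :
    (prepMat χ ρ π E L D.anc M *ᵥ Pi.single (Sum.elim (Sum.elim s 0) 0) 1) z =
      χ (((fun j => z (.inl (.inl j))) + L *ᵥ inp fun i => z (.inr i)) ⬝ᵥ s) *
        ρ (z (.inl (.inr ()))) 0 *
        codeRun D (prodAmp u) E ((fun j => z (.inl (.inl j))) + L *ᵥ inp fun i => z (.inr i))
          (fun i => z (.inr i)) / (√((Fintype.card F : ℝ) ^ K) : ℝ) := by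
  -- The Fourier transform turns the label `s` of the message register into phases on a uniform
  -- superposition of messages. The columns `π b 0` create the noise, and the decoder's ancillas
  -- stay at zero.
  have h1 (z : Wires K (n + D.anc) → F) :
      (tensor (prepLocal χ ρ π K n D.anc) *ᵥ Pi.single (Sum.elim (Sum.elim s 0) 0) 1) z =
      χ ((fun j => z (.inl (.inl j))) ⬝ᵥ s) * ρ (z (.inl (.inr ()))) 0 *
        withAncilla D.anc (prodAmp u) (fun i => z (.inr i)) /
          (√((Fintype.card F : ℝ) ^ K) : ℝ) := by
    rw [mulVec_single_one, col_apply, tensor, Fintype.prod_sum_type, Fintype.prod_sum_type,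
      Fin.prod_univ_add]
    simp only [prepLocal, Sum.elim_inl, Sum.elim_inr, Fin.addCases_left, Fin.addCases_right,
      Pi.zero_apply, hπ, dft, Finset.prod_div_distrib, Finset.prod_const, Finset.card_univ,
      Fintype.card_fin, one_apply, Finset.prod_ite_zero, Finset.mem_univ,
      forall_true_left, Fintype.prod_unique, withAncilla]
    rw [← addChar_sum_apply, sqrt_pow_eq _ (Nat.cast_nonneg _)]
    push_cast
    split_ifs
    · rw [one_pow, mul_one, div_mul_eq_mul_div, div_mul_eq_mul_div]
      rfl
    · simp
  have h2 (z : Wires K (n + D.anc) → F) :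
      (funMat (fun z => z + encodeMat D.anc E *ᵥ z) *ᵥ (tensor (prepLocal χ ρ π K n D.anc) *ᵥ
        Pi.single (Sum.elim (Sum.elim s 0) 0) 1)) z =
      χ ((fun j => z (.inl (.inl j))) ⬝ᵥ s) * ρ (z (.inl (.inr ()))) 0 *
        withAncilla D.anc (noisyState (prodAmp u) (E *ᵥ fun j => z (.inl (.inl j))))
          (fun i => z (.inr i)) / (√((Fintype.card F : ℝ) ^ K) : ℝ) := by
    rw [funMat_mulVec (add_mulVec_sub (encodeMat_sq _ E)) (sub_mulVec_add (encodeMat_sq _ E)), h1,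
      encodeMat_mulVec]
    simp only [Pi.sub_apply, Sum.elim_inl, Sum.elim_inr, sub_zero, withAncilla,
      pad_castAdd, pad_natAdd, noisyState_apply]
    rfl
  have h3 (z : Wires K (n + D.anc) → F) :
      (lift .inr M *ᵥ (funMat (fun z => z + encodeMat D.anc E *ᵥ z) *ᵥ
        (tensor (prepLocal χ ρ π K n D.anc) *ᵥ Pi.single (Sum.elim (Sum.elim s 0) 0) 1))) z =
      χ ((fun j => z (.inl (.inl j))) ⬝ᵥ s) * ρ (z (.inl (.inr ()))) 0 *
        codeRun D (prodAmp u) E (fun j => z (.inl (.inl j))) (fun i => z (.inr i)) /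
          (√((Fintype.card F : ℝ) ^ K) : ℝ) := by
    rw [lift_mulVec, codeRun, Circuit.run, hM]
    simp only [h2, extend_inr, Sum.elim_inl, Sum.elim_inr]
    rw [mulVec]
    simp only [dotProduct]
    rw [Finset.mul_sum, Finset.sum_div]
    refine Finset.sum_congr rfl fun v _ => ?_
    change M (fun i => z (.inr i)) v * _ = _
    ring
  rw [prepMat, ← mulVec_mulVec, ← mulVec_mulVec, ← mulVec_mulVec,
    funMat_mulVec (add_mulVec_sub (decodeMat_sq _ L)) (sub_mulVec_add (decodeMat_sq _ L)), h3,
    decodeMat_mulVec]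
  simp only [Pi.sub_apply, Sum.elim_inl, Sum.elim_inr, sub_zero, Pi.neg_apply,
    sub_neg_eq_add]
  rfl

end Preparation

/-! ### The circuit for bounded distance decoding -/

section Construction

variable {F : Type*} [Field F] [Fintype F] [DecidableEq F] {n K : ℕ}

/-- The matrix that adds the transformed input to the message register. -/
def syndromeMat (a : ℕ) (Fl : Type) (E : Matrix (Fin n) (Fin K) F) :
    Matrix (Fin n ⊕ (Wires K (n + a) ⊕ Fl)) (Fin n ⊕ (Wires K (n + a) ⊕ Fl)) F :=
  fromBlocks 0 0 (fromRows (fromRows (fromRows Eᵀ 0) 0) 0) 0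

/-- The matrix that subtracts the decoder register from the input register. -/
def outputMat (K n a : ℕ) (Fl : Type) :
    Matrix (Fin n ⊕ (Wires K (n + a) ⊕ Fl)) (Fin n ⊕ (Wires K (n + a) ⊕ Fl)) F :=
  fromBlocks 0 (fromCols (fromCols 0 (of fun i => pad a fun i' => -(1 : Matrix _ _ F) i i')) 0) 0 0

theorem syndromeMat_mulVec (a : ℕ) {Fl : Type} [Fintype Fl] (E : Matrix (Fin n) (Fin K) F)
    (x : Fin n ⊕ (Wires K (n + a) ⊕ Fl) → F) :
    syndromeMat a Fl E *ᵥ x = Sum.elim (fun _ => 0) (Sum.elim (Sum.elim (Sum.elim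
      ((fun i => x (.inl i)) ᵥ* E) fun _ => 0) fun _ => 0) fun _ => 0) := by
  rw [syndromeMat, fromBlocks_mulVec, fromRows_mulVec, fromRows_mulVec, fromRows_mulVec,
    mulVec_transpose]
  funext w
  rcases w with w | ((w | w) | w) | w <;> simp
  rfl

theorem outputMat_mulVec (a : ℕ) {Fl : Type} [Fintype Fl]
    (x : Fin n ⊕ (Wires K (n + a) ⊕ Fl) → F) :
    outputMat K n a Fl *ᵥ x =
      Sum.elim (-inp fun i => x (.inr (.inl (.inr i)))) fun _ => 0 := by
  have h : (of fun i : Fin n => pad a fun i' => -(1 : Matrix _ _ F) i i') *ᵥ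
      (fun i => x (.inr (.inl (.inr i)))) = -inp fun i => x (.inr (.inl (.inr i))) := by
    funext i
    simp [mulVec, dotProduct, Fin.sum_univ_add, pad_castAdd, pad_natAdd, one_apply, inp]
  rw [outputMat, fromBlocks_mulVec, fromCols_mulVec, fromCols_mulVec]
  funext w
  rcases w with w | w
  · simp only [zero_mulVec, Sum.elim_inl, zero_add, add_zero]
    exact congrFun h w
  · simp

theorem syndromeMat_sq (a : ℕ) {Fl : Type} [Fintype Fl] (E : Matrix (Fin n) (Fin K) F)
    (x : Fin n ⊕ (Wires K (n + a) ⊕ Fl) → F) :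
    syndromeMat a Fl E *ᵥ (syndromeMat a Fl E *ᵥ x) = 0 := by
  rw [syndromeMat_mulVec a E (syndromeMat a Fl E *ᵥ x), syndromeMat_mulVec]
  funext w
  rcases w with w | ((w | w) | w) | w <;> simp [vecMul, dotProduct]

theorem outputMat_sq (a : ℕ) {Fl : Type} [Fintype Fl]
    (x : Fin n ⊕ (Wires K (n + a) ⊕ Fl) → F) :
    (outputMat K n a Fl : Matrix _ _ F) *ᵥ (outputMat K n a Fl *ᵥ x) = 0 := by
  rw [outputMat_mulVec a (outputMat K n a Fl *ᵥ x), outputMat_mulVec]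
  funext w
  rcases w with w | w <;> simp [inp]

theorem Impl.syndrome (a : ℕ) (Fl : Type) [Fintype Fl] [DecidableEq Fl]
    (E : Matrix (Fin n) (Fin K) F) :
    Impl ((n + (K + 1 + (n + a) + Fintype.card Fl)) * (n + (K + 1 + (n + a) + Fintype.card Fl)) *
      Fintype.card F ^ 4) (funMat fun x => x + syndromeMat a Fl E *ᵥ x) := by
  have hcard : Fintype.card (Fin n ⊕ (Wires K (n + a) ⊕ Fl)) =
      n + (K + 1 + (n + a) + Fintype.card Fl) := by simp
  rw [← hcard]
  refine Impl.shear (Set.range Sum.inr) _ fun t s h => ?_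
  rcases t with t | t <;> rcases s with s | s
  · simp [syndromeMat] at h
  · simp [syndromeMat] at h
  · simp
  · simp [syndromeMat] at h

theorem Impl.output (K n a : ℕ) (Fl : Type) [Fintype Fl] [DecidableEq Fl] :
    Impl ((n + (K + 1 + (n + a) + Fintype.card Fl)) * (n + (K + 1 + (n + a) + Fintype.card Fl)) *
      Fintype.card F ^ 4)
      (funMat fun x : Fin n ⊕ (Wires K (n + a) ⊕ Fl) → F => x + outputMat K n a Fl *ᵥ x) := by
  have hcard : Fintype.card (Fin n ⊕ (Wires K (n + a) ⊕ Fl)) =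
      n + (K + 1 + (n + a) + Fintype.card Fl) := by simp
  rw [← hcard]
  refine Impl.shear (Set.range Sum.inl) _ fun t s h => ?_
  rcases t with t | t <;> rcases s with s | s
  · simp [outputMat] at h
  · simp
  · simp [outputMat] at h
  · simp [outputMat] at h

/-- The shift of the message register by `s`. -/
def messageShift (K N : ℕ) (s : Fin K → F) : Wires K N → F :=
  Sum.elim (Sum.elim s fun _ => 0) fun _ => 0

theorem acts_syndrome (a : ℕ) (Fl : Type) [Fintype Fl] [DecidableEq Fl]
    (E : Matrix (Fin n) (Fin K) F) (y : Fin n → F) :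
    Acts (Fl := Fl) y (funMat fun x => x + syndromeMat a Fl E *ᵥ x)
      (funMat fun z => z + messageShift K (n + a) (y ᵥ* E)) := by
  refine acts_funMat (g := fun x => x - syndromeMat a Fl E *ᵥ x)
    (g' := fun z => z - messageShift K (n + a) (y ᵥ* E)) (add_mulVec_sub (syndromeMat_sq a E))
    (sub_mulVec_add (syndromeMat_sq a E)) (fun z => by simp) (fun z => by simp) (fun x i => ?_)
    (fun x j => ?_) fun x hx => ?_
  · simp [syndromeMat_mulVec]
  · simp [syndromeMat_mulVec]
  · have : (fun i => x (.inl i)) = y := funext hx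
    funext c
    simp only [Pi.sub_apply, syndromeMat_mulVec, Sum.elim_inr, Sum.elim_inl, this, messageShift]

theorem funMat_add_mulVec_single {W : Type} [Fintype W] [DecidableEq W] (s : W → F) :
    funMat (fun z : W → F => z + s) *ᵥ Pi.single 0 (1 : ℂ) = Pi.single s 1 := by
  funext x
  rw [funMat_mulVec (g := fun z => z - s) (fun z => by simp) (fun z => by simp)]
  simp [Pi.single_apply, sub_eq_zero]

/-- A rotation with prescribed corner entry. -/
theorem exists_unitary_corner {a : ℝ} (ha1 : a ^ 2 ≤ 1) :
    ∃ U ∈ unitaryGroup F ℂ, U 0 0 = (a : ℂ) := by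
  obtain ⟨U, hU, h⟩ := exists_unitary_column (0 : F)
    (fun b => if b = 0 then (a : ℂ) else if b = 1 then (√(1 - a ^ 2) : ℝ) else 0) (by
      rw [← Finset.add_sum_erase _ _ (Finset.mem_univ (0 : F)), Finset.sum_eq_single (1 : F)]
      · simp only [if_true, one_ne_zero, if_false, Complex.norm_real, Real.norm_eq_abs, sq_abs]
        rw [Real.sq_sqrt (by linarith)]
        ring
      · intro b hb hb1
        simp [Finset.ne_of_mem_erase hb, hb1]
      · simp)
  exact ⟨U, hU, by simp [h]⟩

/-- The amplitudes on the erased message register after the preparation. -/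
theorem prepared_good (χ : AddChar F ℂ) {ρ π : Matrix F F ℂ} {u : F → ℂ}
    (hπ : ∀ b, π b 0 = u b) (E : Matrix (Fin n) (Fin K) F) (L : Matrix (Fin K) (Fin n) F)
    (D : Circuit F n) {M : Matrix (Fin (n + D.anc) → F) (Fin (n + D.anc) → F) ℂ}
    (hM : ∀ ψ, D.gates.foldl (fun φ g => g.apply φ) ψ = M *ᵥ ψ)
    (hp : 0 < decodeProb D (prodAmp u) E L) {t : ℝ}
    (hρ : ρ 0 0 = ((t / √(decodeProb D (prodAmp u) E L) : ℝ) : ℂ)) (y : Fin n → F)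
    (v : Fin (n + D.anc) → F) :
    ((prepMat χ ρ π E L D.anc M *
        funMat (fun z => z + messageShift K (n + D.anc) (y ᵥ* E))) *ᵥ Pi.single 0 1)
      (Sum.elim (fun _ => 0) v) = (t : ℂ) * decodedState χ D (prodAmp u) E L y v := by
  rw [← mulVec_mulVec, funMat_add_mulVec_single]
  refine (prepMat_mulVec_single χ hπ E L D hM (y ᵥ* E) _).trans ?_
  -- On the zero label the register has been cancelled, so the original message was exactly `L *ᵥ
  -- inp v`.
  have h0 : (fun j : Fin K => (0 : F)) + L *ᵥ inp v = L *ᵥ inp v := zero_add _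
  simp only [Sum.elim_inl, Sum.elim_inr, h0, hρ, decodedState]
  have h1 : (√(decodeProb D (prodAmp u) E L) : ℂ) ≠ 0 := by
    exact_mod_cast (Real.sqrt_pos.2 hp).ne'
  have hq : (0 : ℝ) < Fintype.card F := by exact_mod_cast Fintype.card_pos
  have h2 : (√((Fintype.card F : ℝ) ^ K) : ℂ) ≠ 0 := by
    exact_mod_cast (Real.sqrt_pos.2 (by positivity)).ne'
  push_cast
  field_simp

/-- The prepared state after amplitude amplification. -/
theorem amplified_eq (χ : AddChar F ℂ) {ρ π : Matrix F F ℂ} {u : F → ℂ}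
    (hπ : ∀ b, π b 0 = u b) (E : Matrix (Fin n) (Fin K) F) (L : Matrix (Fin K) (Fin n) F)
    (D : Circuit F n) {M : Matrix (Fin (n + D.anc) → F) (Fin (n + D.anc) → F) ℂ}
    (hM : ∀ ψ, D.gates.foldl (fun φ g => g.apply φ) ψ = M *ᵥ ψ)
    (hp : 0 < decodeProb D (prodAmp u) E L) {m : ℕ} (hm : 1 ≤ m)
    (hρ : ρ 0 0 = ((Real.sin (Real.pi / (2 * (2 * m + 1))) /
      √(decodeProb D (prodAmp u) E L) : ℝ) : ℂ)) (y : Fin n → F)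
    {U : Matrix (Wires K (n + D.anc) → F) (Wires K (n + D.anc) → F) ℂ}
    (hU : U = prepMat χ ρ π E L D.anc M *
      funMat (fun z => z + messageShift K (n + D.anc) (y ᵥ* E)))
    (hUU : U ∈ unitaryGroup (Wires K (n + D.anc) → F) ℂ) (v : Fin (n + D.anc) → F) :
    (((U * diagonal (fun x => if x = 0 then (1 : ℂ) else -1) * Uᴴ *
        diagonal (fun x => if x ∈ {z : Wires K (n + D.anc) → F | ∀ w, z (.inl w) = 0}
          then (1 : ℂ) else -1)) ^ m) *ᵥ (U *ᵥ Pi.single 0 1)) (Sum.elim (fun _ => 0) v) =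
      (-1) ^ m * decodedState χ D (prodAmp u) E L y v := by
  set θ : ℝ := Real.pi / (2 * (2 * m + 1)) with hθ
  have hm' : (1 : ℝ) ≤ m := by exact_mod_cast hm
  have hs : 0 < Real.sin θ := by
    refine Real.sin_pos_of_pos_of_lt_pi (by positivity) ?_
    rw [hθ]
    apply div_lt_self Real.pi_pos
    linarith
  have hgood (v : Fin (n + D.anc) → F) : (U *ᵥ Pi.single 0 1) (Sum.elim (fun _ => 0) v) =
      (Real.sin θ : ℂ) * decodedState χ D (prodAmp u) E L y v := by
    rw [hU]
    exact_mod_cast prepared_good χ hπ E L D hM hp hρ y v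
  have hsum : ∑ x, (if x ∈ {z : Wires K (n + D.anc) → F | ∀ w, z (.inl w) = 0} then
      ‖(U *ᵥ Pi.single 0 1) x‖ ^ 2 else 0) = Real.sin θ ^ 2 := by
    have h1 : ∑ v, ‖(U *ᵥ Pi.single 0 1) (Sum.elim (fun _ => 0) v)‖ ^ 2 = Real.sin θ ^ 2 := by
      simp only [hgood, norm_mul, mul_pow, ← Finset.mul_sum,
        sum_norm_sq_decodedState χ D (prodAmp u) E L hp y, mul_one, Complex.norm_real,
        Real.norm_eq_abs, sq_abs]
    rw [← h1]
    symm
    refine Fintype.sum_of_injective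
      (fun v : Fin (n + D.anc) → F => (Sum.elim (fun _ => 0) v : Wires K (n + D.anc) → F))
      ?_ _ _ ?_ ?_
    · intro v v' h
      exact funext fun i => congrFun h (.inr i)
    · intro x hx
      refine if_neg fun h => hx ⟨fun i => x (.inr i), ?_⟩
      funext w
      rcases w with w | w
      · exact (h w).symm
      · rfl
    · intro v
      exact (if_pos fun _ => rfl).symm
  rw [amplification hUU 0 _ hm hsum]
  have hmem : (Sum.elim (fun _ => 0) v : Wires K (n + D.anc) → F) ∈
      {z : Wires K (n + D.anc) → F | ∀ w, z (.inl w) = 0} := fun _ => rfl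
  beta_reduce
  rw [if_pos hmem, hgood]
  have : (Real.sin θ : ℂ) ≠ 0 := by exact_mod_cast hs.ne'
  rw [← hθ, mul_div_cancel_left₀ _ this]

/-- Everything apart from the input register, work wires and flags alike, is an ancilla of the final
circuit; `e` numbers these wires. -/
theorem withAncilla_ket (r : ℕ) {C Fl : Type} [Fintype C] [DecidableEq C] [Fintype Fl]
    [DecidableEq Fl] (e : C ⊕ Fl ≃ Fin r) (y : Fin n → F) (z : Fin n ⊕ (C ⊕ Fl) → F) :
    withAncilla r (ket y)
      (z ∘ ((Equiv.sumCongr (Equiv.refl (Fin n)) e).trans finSumFinEquiv).symm) =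
      emb Fl y (Pi.single 0 1) z := by
  have h1 : (∀ j : Fin r, (z ∘ ((Equiv.sumCongr (Equiv.refl (Fin n)) e).trans
      finSumFinEquiv).symm) (Fin.natAdd n j) = 0) ↔
      (∀ c, z (.inr (.inl c)) = 0) ∧ ∀ j, z (.inr (.inr j)) = 0 := by
    constructor
    · intro h
      exact ⟨fun c => by simpa using h (e (.inl c)), fun j => by simpa using h (e (.inr j))⟩
    · rintro ⟨h, h'⟩ j
      simp only [Function.comp_apply, Equiv.symm_trans_apply, finSumFinEquiv_symm_apply_natAdd,
        Equiv.sumCongr_symm, Equiv.sumCongr_apply, Sum.map_inr]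
      rcases e.symm j with c | j
      · exact h c
      · exact h' j
  have h2 : (fun i => (z ∘ ((Equiv.sumCongr (Equiv.refl (Fin n)) e).trans
      finSumFinEquiv).symm) (Fin.castAdd r i)) = fun i => z (.inl i) := by
    funext i
    simp
  rw [withAncilla, emb, h2]
  simp only [h1, ket, Pi.single_apply, funext_iff, Pi.zero_apply]
  split_ifs <;> tauto

end Construction

/-! ### Assembly and cost of the decoding circuit -/

section Main

variable {F : Type*} [Field F] [Fintype F] [DecidableEq F] {n K : ℕ}

theorem decodingCircuit_cost_le {n K N c s m Q : ℕ} (hn : 1 ≤ n) (hKn : K ≤ n) (hQ : 1 ≤ Q)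
    (hm : 1 ≤ m) (hs : n + (N - n) + c ≤ s) (hN : n ≤ N) :
    let k := K + 1 + N
    let w := n + (k + (k + 1))
    let u := (k * k * Q ^ 4 + (c + (k * k * Q ^ 4 + k * Q ^ 2))) + w * w * Q ^ 4
    let r := (2 * k + 1) * Q ^ 6
    w + (w * w * Q ^ 4 + ((N * Q ^ 2 + c) + (m * (((u + r) + u) + r) + u))) ≤
      1344 * m * s ^ 2 * Q ^ 6 := by
  intro k w u r
  have hws : w ≤ 8 * s := by omega
  -- All wire counts are at most `8 * s`, so every elementary block costs at most `X`. A preparation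
  -- takes at most `5 * X`, an amplification round `12 * X`, and the total is at most `21 * m * X`,
  -- with `21 * 64 = 1344`.
  set X := 64 * s ^ 2 * Q ^ 6 with hX
  have hs1 : 1 ≤ s := by omega
  have hQ2 : Q ^ 2 ≤ Q ^ 6 := Nat.pow_le_pow_right hQ (by norm_num)
  have hQ4 : Q ^ 4 ≤ Q ^ 6 := Nat.pow_le_pow_right hQ (by norm_num)
  have hQ1 : 1 ≤ Q ^ 6 := Nat.one_le_pow _ _ hQ
  have hsq {a b : ℕ} (ha : a ≤ 8 * s) (hb : b ≤ 8 * s) {x : ℕ} (hx : x ≤ Q ^ 6) :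
      a * b * x ≤ X := by
    calc a * b * x ≤ (8 * s) * (8 * s) * Q ^ 6 := by gcongr
      _ = X := by rw [hX]; ring
  have h1 {a : ℕ} (ha : a ≤ 8 * s) {x : ℕ} (hx : x ≤ Q ^ 6) : a * x ≤ X := by
    have := hsq ha (by omega : 1 ≤ 8 * s) hx
    simpa using this
  have h0 {a : ℕ} (ha : a ≤ 8 * s) : a ≤ X := by simpa using h1 ha hQ1
  have hww := hsq hws hws hQ4
  have hkk := hsq (by omega : k ≤ 8 * s) (by omega : k ≤ 8 * s) hQ4
  have hk := h1 (by omega : k ≤ 8 * s) hQ2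
  have hc := h0 (by omega : c ≤ 8 * s)
  have hr : r ≤ X := h1 (by omega : 2 * k + 1 ≤ 8 * s) le_rfl
  have hw := h0 hws
  have hNQ := h1 (by omega : N ≤ 8 * s) hQ2
  have hu : u ≤ 5 * X := by
    simp only [u]
    omega
  have hit : m * (((u + r) + u) + r) ≤ m * (12 * X) := Nat.mul_le_mul_left _ (by omega)
  have hXm : X ≤ m * X := Nat.le_mul_of_pos_left X hm
  have : 1344 * m * s ^ 2 * Q ^ 6 = 21 * (m * X) := by
    rw [hX]
    ring
  rw [this]
  have : m * (12 * X) = 12 * (m * X) := by ring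
  omega

/-- A circuit that, on input `y`, outputs `y` minus the outcome of measuring the Fourier transform
of the uncomputed state of the decoder. -/
theorem exists_decodingCircuit {χ : AddChar F ℂ} (hχ : χ.IsPrimitive) {u : F → ℂ}
    (hu : ∑ a, ‖u a‖ ^ 2 = 1) (E : Matrix (Fin n) (Fin K) F) (L : Matrix (Fin K) (Fin n) F)
    (hn : 1 ≤ n) (hKn : K ≤ n)
    (D : Circuit F n) {M : Matrix (Fin (n + D.anc) → F) (Fin (n + D.anc) → F) ℂ}
    (hMI : Impl (D.gates.map Gate.cost).sum M)
    (hM : ∀ ψ, D.gates.foldl (fun φ g => g.apply φ) ψ = M *ᵥ ψ)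
    (hp : 0 < decodeProb D (prodAmp u) E L) {m : ℕ} (hm : 1 ≤ m)
    (hmp : Real.sin (Real.pi / (2 * (2 * m + 1))) ^ 2 ≤ decodeProb D (prodAmp u) E L) :
    ∃ A : Circuit F n, A.size ≤ 1344 * m * D.size ^ 2 * Fintype.card F ^ 6 ∧
      ∃ h : (Fin (n + D.anc) → F) → Fin A.anc → F, Function.Injective h ∧
        ∀ y v, ‖A.run (ket y) (Fin.append (y - inp v) (h v))‖ =
          ‖(tensor (dftInp χ n D.anc) *ᵥ
            (Mᴴ *ᵥ decodedState χ D (prodAmp u) E L y)) v‖ := by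
  let C := Wires K (n + D.anc)
  let r := K + 1 + (n + D.anc)
  let Fl := Fin (r + 1)
  obtain ⟨π, hπU, hπ⟩ := exists_unitary_column (0 : F) u hu
  obtain ⟨ρ, hρU, hρ⟩ := exists_unitary_corner (F := F)
    (a := Real.sin (Real.pi / (2 * (2 * m + 1))) / √(decodeProb D (prodAmp u) E L)) (by
      rw [div_pow, Real.sq_sqrt hp.le, div_le_one hp]
      exact hmp)
  -- the preparation
  let prep := prepMat χ ρ π E L D.anc M
  have hprep := Impl.prepMat hχ hρU hπU E L D.anc hMI
  let UW := lift (work (Fin n) C Fl) prep * funMat fun x => x + syndromeMat D.anc Fl E *ᵥ x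
  let UC : (Fin n → F) → Matrix (C → F) (C → F) ℂ := fun y =>
    prep * funMat (fun z => z + messageShift K (n + D.anc) (y ᵥ* E))
  have hUW := (hprep.lift (work (Fin n) C Fl)).mul (Impl.syndrome D.anc Fl E)
  have hUC (y : Fin n → F) : UC y ∈ unitaryGroup (C → F) ℂ :=
    mul_mem hprep.mem_unitary (funMat_mem_unitary
      (g := fun z => z - messageShift K (n + D.anc) (y ᵥ* E)) (fun z => by simp) fun z => by simp)
  have hactU (y : Fin n → F) : Acts y UW (UC y) := (acts_lift y prep).mul (acts_syndrome D.anc Fl E y)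
  -- the reflections
  let ec : Fin r ≃ C := (Fintype.equivFinOfCardEq (by simp [C, r])).symm
  let c : Fin r ↪ Fin n ⊕ (C ⊕ Fl) := ec.toEmbedding.trans (work (Fin n) C Fl)
  let b : Fin (r + 1) ↪ Fin n ⊕ (C ⊕ Fl) := Function.Embedding.inr.trans .inr
  have hcb : ∀ i j, c i ≠ b j := fun i j h => by simp [c, b, work] at h
  -- The first reflection tests all work wires for zero. The second leaves the decoder register free
  -- and tests only the message register and the rotation qudit.
  obtain ⟨d₀, hd₀, hd₀1, hd₀2⟩ := exists_reflection (F := F) r c b hcb fun _ => {0}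
  obtain ⟨d₁, hd₁, hd₁1, hd₁2⟩ := exists_reflection (F := F) r c b hcb
    fun i => {x | ∀ w, ec i = .inl w → x = 0}
  let g₀ : (C → F) → ℂ := fun x => if x = 0 then (1 : ℂ) else -1
  let g₁ : (C → F) → ℂ := fun x =>
    if x ∈ {z : C → F | ∀ w, z (.inl w) = 0} then (1 : ℂ) else -1
  have hact₀ (y : Fin n → F) : Acts (Fl := Fl) y (diagonal d₀) (diagonal g₀) := by
    refine acts_diagonal fun x hx => ?_
    have hiff : (∀ i, x (c i) ∈ ({0} : Set F)) ↔ (fun c => x (.inr (.inl c))) = 0 := by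
      refine ⟨fun h => funext fun w => ?_, fun h i => congrFun h _⟩
      have := h (ec.symm w)
      simpa [c, work] using this
    by_cases h : ∀ i, x (c i) ∈ ({0} : Set F)
    · rw [hd₀1 x hx h]
      exact (if_pos (hiff.1 h)).symm
    · rw [hd₀2 x hx h]
      exact (if_neg fun h' => h (hiff.2 h')).symm
  have hact₁ (y : Fin n → F) : Acts (Fl := Fl) y (diagonal d₁) (diagonal g₁) := by
    refine acts_diagonal fun x hx => ?_
    have hiff : (∀ i, x (c i) ∈ {x : F | ∀ w, ec i = .inl w → x = 0}) ↔
        (fun c => x (.inr (.inl c))) ∈ {z : C → F | ∀ w, z (.inl w) = 0} := by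
      constructor
      · intro h w
        have := h (ec.symm (.inl w)) w (by simp)
        simpa [c, work] using this
      · intro h i w hw
        have := h w
        rw [← hw] at this
        exact this
    by_cases h : ∀ i, x (c i) ∈ {x : F | ∀ w, ec i = .inl w → x = 0}
    · rw [hd₁1 x hx h]
      exact (if_pos (hiff.1 h)).symm
    · rw [hd₁2 x hx h]
      exact (if_neg fun h' => h (hiff.2 h')).symm
  -- the whole circuit
  let R := tensor (dftInp χ n D.anc)
  have hR := Impl.tensor (dftInp_mem_unitary hχ n D.anc)
  have hpost := ((hR.mul hMI.conjTranspose).lift (Function.Embedding.inr : _ ↪ C)).lift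
    (work (Fin n) C Fl)
  have hall := (Impl.output (F := F) K n D.anc Fl).mul (hpost.mul
    (((((hUW.mul hd₀).mul hUW.conjTranspose).mul hd₁).pow m).mul hUW))
  have hact (y : Fin n → F) := (acts_lift (Fl := Fl) y (lift .inr (R * Mᴴ) : Matrix (C → F) _ ℂ)).mul
    ((((((hactU y).mul (hact₀ y)).mul ((hactU y).conjTranspose hUW.mem_unitary (hUC y))).mul
      (hact₁ y)).pow m).mul (hactU y))
  let e := (Equiv.sumCongr (Equiv.refl (Fin n)) (Fintype.equivFin (C ⊕ Fl))).trans finSumFinEquiv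
  obtain ⟨l, hl, hlM⟩ := (hall.lift e.toEmbedding).exists_gates
  refine ⟨⟨Fintype.card (C ⊕ Fl), l⟩, ?_, fun v j =>
    (Sum.elim (Sum.elim (fun _ => 0) v) fun _ => 0 : C ⊕ Fl → F)
      ((Fintype.equivFin (C ⊕ Fl)).symm j), ?_, fun y v => ?_⟩
  · have hcost := decodingCircuit_cost_le (s := D.size) (N := n + D.anc) hn hKn
      (Fintype.card_pos (α := F)) hm
      (c := (D.gates.map Gate.cost).sum) (by simp [Circuit.size]) (by omega)
    refine le_trans ?_ hcost
    have hFl : Fintype.card Fl = K + 1 + (n + D.anc) + 1 := by simp [Fl, r]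
    have hCFl : Fintype.card (C ⊕ Fl) = K + 1 + (n + D.anc) + (K + 1 + (n + D.anc) + 1) := by
      rw [Fintype.card_sum, hFl]
      simp [C]
    rw [hFl, Fintype.card_fin] at hl
    rw [Circuit.size]
    refine add_le_add ?_ hl
    simp only [hCFl, le_refl]
  -- The ancillas retain all of `v`, so distinct `v` are distinct measurement outcomes and their
  -- probabilities add.
  · intro v v' h
    funext i
    have := congrFun h (Fintype.equivFin (C ⊕ Fl) (.inl (.inr i)))
    simpa using this
  · have hext (z x : _ → F) : Function.extend e.toEmbedding z x = z ∘ e.symm := by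
      refine Eq.symm ((eq_extend_iff _ _ _ _).2 ⟨?_, fun w hw => absurd ⟨e.symm w, by simp⟩ hw⟩)
      funext w
      simp
    rw [Circuit.run, hlM, lift_mulVec]
    simp only [hext]
    have hinit (z : Fin n ⊕ (C ⊕ Fl) → F) : withAncilla (Fintype.card (C ⊕ Fl)) (ket y)
        (z ∘ e.symm) = emb Fl y (Pi.single 0 1) z := withAncilla_ket _ _ y z
    simp only [hinit]
    set x₁ : Fin n ⊕ (C ⊕ Fl) → F :=
      Sum.elim (y - inp v) (Sum.elim (Sum.elim (fun _ => 0) v) fun _ => 0) with hx₁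
    have hx : Fin.append (y - inp v) (fun j =>
        (Sum.elim (Sum.elim (fun _ => 0) v) fun _ => 0 : C ⊕ Fl → F)
          ((Fintype.equivFin (C ⊕ Fl)).symm j)) ∘ e.toEmbedding = x₁ := by
      funext w
      rcases w with w | w
      · simp [e, hx₁]
      · simp [e, hx₁]
    rw [hx]
    change ‖((funMat (fun x => x + outputMat K n D.anc Fl *ᵥ x) * _) *ᵥ
      emb Fl y (Pi.single 0 1)) x₁‖ = _
    rw [← mulVec_mulVec, funMat_mulVec (add_mulVec_sub (outputMat_sq D.anc))
      (sub_mulVec_add (outputMat_sq D.anc))]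
    refine (congrArg (fun ψ : _ → ℂ => ‖ψ (x₁ - outputMat K n D.anc Fl *ᵥ x₁)‖)
      (hact y (Pi.single 0 1))).trans ?_
    -- Undoing the final subtraction restores the label `y`, where the analysis of the amplified
    -- state applies.
    have hpt : x₁ - outputMat K n D.anc Fl *ᵥ x₁ =
        Sum.elim y (Sum.elim (Sum.elim (fun _ => 0) v) fun _ => 0) := by
      funext w
      rcases w with w | w
      · simp [outputMat_mulVec, hx₁]
      · simp [outputMat_mulVec, hx₁]
    rw [hpt, emb, if_pos ⟨fun _ => rfl, fun _ => rfl⟩]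
    change ‖((lift .inr (R * Mᴴ) * _) *ᵥ Pi.single 0 1) (Sum.elim (fun _ => 0) v)‖ = _
    rw [← mulVec_mulVec, ← mulVec_mulVec, lift_mulVec]
    simp only [extend_inr, Sum.elim_inl]
    rw [Finset.sum_congr rfl fun z _ => congrArg _
      (amplified_eq χ hπ E L D hM hp hm hρ y (U := UC y) rfl (hUC y) z)]
    simp only [mul_left_comm _ ((-1 : ℂ) ^ m), ← Finset.mul_sum]
    rw [norm_mul, norm_pow, norm_neg, norm_one, one_pow, one_mul, mulVec_mulVec]
    rfl

end Main

/-! ### The reduction for fixed parameters -/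

theorem exists_primitive_addChar (F : Type*) [Field F] [Fintype F] :
    ∃ χ : AddChar F ℂ, χ.IsPrimitive :=
  ⟨_, AddChar.FiniteField.primitiveChar_to_Complex_isPrimitive F⟩

theorem sum_comp_le_of_injective {A B : Type*} [Fintype A] [Fintype B] {h : A → B}
    (hh : Function.Injective h) {g : B → ℝ} (hg : ∀ b, 0 ≤ g b) : ∑ a, g (h a) ≤ ∑ b, g b := by
  classical
  rw [← Finset.sum_image (f := g) (g := h) fun a _ b _ e => hh e]
  exact Finset.sum_le_univ_sum_of_nonneg hg

/-- Taking `m = ⌈1 / P⌉₊` rounds makes the target amplitude at most `1 / m ≤ P`, so its square is at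
most `P`. This makes the corner entry of the rotation admissible, since `P ≤ decodeProb`. -/
theorem sq_sin_le {P : ℝ} (hP : 0 < P) (hP1 : P ≤ 1) :
    Real.sin (Real.pi / (2 * (2 * (⌈1 / P⌉₊ : ℝ) + 1))) ^ 2 ≤ P := by
  set m : ℝ := (⌈1 / P⌉₊ : ℝ) with hm
  have h1 : 1 / P ≤ m := Nat.le_ceil _
  have h1P : 1 ≤ 1 / P := by rw [le_div_iff₀ hP]; linarith
  have hm1 : 1 ≤ m := h1P.trans h1
  have hx0 : 0 ≤ Real.pi / (2 * (2 * m + 1)) := by positivity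
  have hx1 : Real.pi / (2 * (2 * m + 1)) ≤ 1 / m := by
    rw [div_le_div_iff₀ (by positivity) (by positivity)]
    nlinarith [Real.pi_le_four]
  have hs0 : 0 ≤ Real.sin (Real.pi / (2 * (2 * m + 1))) := by
    refine Real.sin_nonneg_of_nonneg_of_le_pi hx0 (hx1.trans ?_)
    have : 1 / m ≤ 1 := by rw [div_le_one (by linarith)]; exact hm1
    linarith [Real.pi_gt_three]
  have hs1 : Real.sin (Real.pi / (2 * (2 * m + 1))) ≤ 1 / m := (Real.sin_le hx0).trans hx1
  have hmP : 1 / m ≤ P := by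
    rw [div_le_iff₀ (by linarith)]
    rw [div_le_iff₀ hP] at h1
    linarith
  have hm' : 1 / m ≤ 1 := hmP.trans hP1
  have hm0 : 0 ≤ 1 / m := by positivity
  nlinarith

open Classical in
theorem sum_le_ibddSuccess {F : Type*} [Field F] [Fintype F] [DecidableEq F] {n N : ℕ}
    (C : Submodule F (Fin n → F)) (t : ℝ) (A : Circuit F n)
    {h : (Fin (n + N) → F) → Fin A.anc → F} (hh : Function.Injective h) :
    (∑ y, ∑ v : Fin (n + N) → F,
      if y - inp v ∈ C ∧ (hammingDist (y - inp v) y : ℝ) ≤ t then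
        ‖A.run (ket y) (Fin.append (y - inp v) (h v))‖ ^ 2 else 0) / (Fintype.card F : ℝ) ^ n ≤
      ibddSuccess C t A := by
  rw [ibddSuccess]
  have hcard : (Nat.card (Fin n → F) : ℝ) = (Fintype.card F : ℝ) ^ n := by simp
  rw [hcard]
  refine div_le_div_of_nonneg_right ?_ (by positivity)
  refine Finset.sum_le_sum fun y _ => ?_
  rw [Finset.sum_filter]
  let g : (Fin n → F) × (Fin A.anc → F) → ℝ := fun p =>
    if p.1 ∈ C ∧ (hammingDist p.1 y : ℝ) ≤ t then
      ‖A.run (ket y) (Fin.append p.1 p.2)‖ ^ 2 else 0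
  have hle := sum_comp_le_of_injective (h := fun v => (y - inp v, h v))
    (fun v v' e => hh (Prod.ext_iff.1 e).2) (g := g) fun p => by
      simp only [g]
      split_ifs <;> positivity
  refine hle.trans (le_of_eq ?_)
  rw [Fintype.sum_prod_type]
  refine Finset.sum_congr rfl fun c _ => ?_
  simp only [g, Circuit.outputProb]
  split_ifs
  · rfl
  · simp

theorem ibddSuccess_nonneg {F : Type*} [Field F] [Fintype F] [DecidableEq F] {n : ℕ}
    (C : Submodule F (Fin n → F)) (t : ℝ) (A : Circuit F n) : 0 ≤ ibddSuccess C t A := by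
  rw [ibddSuccess]
  refine div_nonneg (Finset.sum_nonneg fun y _ => Finset.sum_nonneg fun c _ => ?_) (by positivity)
  exact Finset.sum_nonneg fun w _ => by positivity

/-- The reduction for a single choice of the parameters. -/
theorem exists_ibdd_circuit {F : Type*} [Field F] [Fintype F] [DecidableEq F] {q : ℕ}
    (hq : Fintype.card F = q) (α : Fin q ≃ F) {k : ℕ} (hk : 1 ≤ k) {τ : ℝ} (h0 : 0 < τ)
    (h1 : τ < 1 - 1 / (q : ℝ)) {P : ℝ} (hP : 0 < P) (D : Circuit F q)
    (hDP : P ≤ qdpSuccess (reedSolomon α (q - k)) (prodAmp (bernoulliAmp F τ)) D) :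
    ∃ A : Circuit F q, (A.size : ℝ) ≤ ((2688 * D.size ^ 2 * q ^ 6 : ℕ) : ℝ) / P ∧
      P - 3 * Real.exp (-((tauPerp q τ * q) ^ (1 / 3 : ℝ)) / 6) ≤
        ibddSuccess (reedSolomon α k) (tauPrime q τ * q) A := by
  classical
  obtain ⟨χ, hχ⟩ := exists_primitive_addChar F
  obtain ⟨L, hL⟩ := exists_enc_leftInverse α.injective (Nat.sub_le q k)
  obtain ⟨M, hMI, hM⟩ := exists_impl_of_gates D.gates
  have h1' : τ < 1 - 1 / (Fintype.card F : ℝ) := by rw [hq]; exact h1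
  have hu := sum_norm_sq_bernoulliAmp h0 h1'
  have hf := sum_norm_sq_prodAmp hu q
  have hPp := hDP.trans (qdpSuccess_le_decodeProb α.injective (Nat.sub_le q k) D _ hL)
  have hP1 : P ≤ 1 := hPp.trans (decodeProb_le_one D hf _ L)
  have hp := hP.trans_le hPp
  have hq1 : 1 ≤ q := by
    rw [← hq]
    exact Fintype.card_pos
  have h1P : 1 ≤ 1 / P := by rw [le_div_iff₀ hP]; linarith
  have hm : 1 ≤ ⌈1 / P⌉₊ := by
    rw [Nat.one_le_ceil_iff]
    positivity
  obtain ⟨A, hA, h, hh, hrun⟩ := exists_decodingCircuit hχ hu (enc α (q - k)) L hq1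
    (Nat.sub_le q k) D hMI hM hp hm ((sq_sin_le hP hP1).trans hPp)
  refine ⟨A, ?_, ?_⟩
  -- Since `1 ≤ 1 / P`, rounding up at most doubles the number of rounds, which turns `1344` into
  -- `2688`.
  · have hceil : (⌈1 / P⌉₊ : ℝ) ≤ 2 / P := by
      have := (Nat.ceil_lt_add_one (by positivity : 0 ≤ 1 / P)).le
      have e : 2 / P = 1 / P + 1 / P := by ring
      linarith
    rw [hq] at hA
    have hA' : (A.size : ℝ) ≤ 1344 * ⌈1 / P⌉₊ * (D.size : ℝ) ^ 2 * (q : ℝ) ^ 6 := by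
      exact_mod_cast hA
    refine hA'.trans ?_
    calc 1344 * (⌈1 / P⌉₊ : ℝ) * (D.size : ℝ) ^ 2 * (q : ℝ) ^ 6
        ≤ 1344 * (2 / P) * (D.size : ℝ) ^ 2 * (q : ℝ) ^ 6 := by gcongr
      _ = ((2688 * D.size ^ 2 * q ^ 6 : ℕ) : ℝ) / P := by
        push_cast
        ring
  · by_cases hμ : 1 ≤ tauPerp q τ * q
    · have hmain := decodeProb_sub_le hq α hk h0 h1 hμ D hχ hf hp hMI.mem_unitary hM
        (fun y x => y - x ∈ reedSolomon α k ∧ (hammingDist (y - x) y : ℝ) ≤ tauPrime q τ * q)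
        fun y x hyx hx => ⟨hyx, by
          have : hammingDist (y - x) y = hammingNorm x := by
            rw [hammingDist_eq_hammingNorm]
            congr 1
            abel
          rw [this]
          exact hx⟩
      simp only [← hrun] at hmain
      have hle := sum_le_ibddSuccess (reedSolomon α k) (tauPrime q τ * q) A hh
      rw [hq] at hle
      linarith
    -- When `τ^⊥ q < 1` the Chernoff bound is unavailable, but the claim is empty: the subtracted
    -- term is at least `3 * (1 - 1/6)`, which exceeds `1 ≥ P`.
    · have hμ0 : 0 ≤ tauPerp q τ * q := by
        rw [tauPerp]
        positivity
      have hr : (tauPerp q τ * q) ^ (1 / 3 : ℝ) ≤ 1 :=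
        Real.rpow_le_one hμ0 (by linarith) (by norm_num)
      have hexp := Real.add_one_le_exp (-((tauPerp q τ * q) ^ (1 / 3 : ℝ)) / 6)
      have := ibddSuccess_nonneg (reedSolomon α k) (tauPrime q τ * q) A
      linarith

/-! ### Asymptotics -/

theorem negligible_exp {ι : Type*} (q : ι → ℕ) (μ : ι → ℝ)
    (h : Tendsto (fun i => μ i / Real.log (q i) ^ 3) (comap q atTop) atTop) :
    Negligible q fun i => 3 * Real.exp (-(μ i ^ (1 / 3 : ℝ)) / 6) := by
  have hq : Tendsto (fun i => (q i : ℝ)) (comap q atTop) atTop :=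
    tendsto_natCast_atTop_atTop.comp tendsto_comap
  have hinv : Tendsto (fun i => 3 * (q i : ℝ)⁻¹) (comap q atTop) (𝓝 0) := by
    simpa using (tendsto_inv_atTop_zero.comp hq).const_mul 3
  intro c
  refine squeeze_zero' (Eventually.of_forall fun i => by positivity) ?_ hinv
  -- This threshold makes the exponential at most `q ^ (-(c + 1))`; the extra power leaves `3 / q`
  -- after multiplication by `q ^ c`.
  have hc := h.eventually_ge_atTop ((6 * (c + 1)) ^ 3 : ℝ)
  filter_upwards [hc, hq.eventually_gt_atTop 1] with i hi hqi
  have hlog : 0 < Real.log (q i) := Real.log_pos hqi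
  rw [le_div_iff₀ (by positivity), ← mul_pow] at hi
  have hroot : 6 * (c + 1) * Real.log (q i) ≤ μ i ^ (1 / 3 : ℝ) := by
    have h3 := Real.rpow_le_rpow (by positivity) hi (by norm_num : (0 : ℝ) ≤ 1 / 3)
    rwa [← Real.rpow_natCast, ← Real.rpow_mul (by positivity), show ((3 : ℕ) : ℝ) * (1 / 3) = 1 by
      norm_num, Real.rpow_one] at h3
  have hexp : Real.exp (-(μ i ^ (1 / 3 : ℝ)) / 6) ≤ ((q i : ℝ) ^ (c + 1))⁻¹ := by
    have hq0 : (0 : ℝ) < q i := by linarith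
    calc Real.exp (-(μ i ^ (1 / 3 : ℝ)) / 6)
        ≤ Real.exp (-(((c + 1 : ℕ) : ℝ) * Real.log (q i))) := by
          rw [Real.exp_le_exp]
          push_cast
          linarith
      _ = ((q i : ℝ) ^ (c + 1))⁻¹ := by
          rw [Real.exp_neg, Real.exp_nat_mul, Real.exp_log hq0]
  have hq0 : (0 : ℝ) < q i := by linarith
  calc (q i : ℝ) ^ c * (3 * Real.exp (-(μ i ^ (1 / 3 : ℝ)) / 6))
      ≤ (q i : ℝ) ^ c * (3 * ((q i : ℝ) ^ (c + 1))⁻¹) := by gcongr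
    _ = 3 * (q i : ℝ)⁻¹ := by
      rw [pow_succ]
      field_simp

theorem tendsto_tauPrime_div_tauPerp {ι : Type*} (q : ι → ℕ) (τ : ι → ℝ) (l : Filter ι)
    (h : Tendsto (fun i => tauPerp (q i) (τ i) * q i) l atTop) :
    Tendsto (fun i => tauPrime (q i) (τ i) / tauPerp (q i) (τ i)) l (𝓝 1) := by
  have h1 : Tendsto (fun i => 1 + (tauPerp (q i) (τ i) * q i) ^ (-(1 / 3 : ℝ))) l (𝓝 (1 + 0)) :=
    ((tendsto_rpow_neg_atTop (by norm_num : (0 : ℝ) < 1 / 3)).comp h).const_add 1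
  rw [add_zero] at h1
  refine h1.congr' ?_
  filter_upwards [h.eventually_gt_atTop 0] with i hi
  have : tauPerp (q i) (τ i) ≠ 0 := fun e => by simp [e] at hi
  rw [tauPrime, mul_div_cancel_left₀ _ this]

end
end QuditRS

theorem theorem4p4 {ι : Type*} (F : ι → Type*) [∀ i, Field (F i)] [∀ i, Fintype (F i)]
    [∀ i, DecidableEq (F i)]
    -- `q i` is the size of the field `F i`
    (q : ι → ℕ) (hq : ∀ i, Fintype.card (F i) = q i)
    -- full-support evaluation points
    (α : ∀ i, Fin (q i) ≃ F i)
    (k : ι → ℕ) (hk : ∀ i, 1 ≤ k i ∧ k i + 1 ≤ q i)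
    (τ : ι → ℝ) (hτ : ∀ i, 0 < τ i ∧ τ i < 1 - 1 / (q i : ℝ))
    -- an efficient algorithm for `QDP(RS[q, q-k]_q, τ)` with success probability `P`
    (P : ι → ℝ) (hP : ∀ i, 0 < P i)
    (D : ∀ i, Circuit (F i) (q i)) (hD : PolyBounded q fun i => (D i).size)
    (hDP : ∀ i, P i ≤
      qdpSuccess (reedSolomon (α i) (q i - k i)) (prodAmp (bernoulliAmp (F i) (τ i))) (D i)) :
    (∃ (E : ∀ i, Circuit (F i) (q i)) (ε : ι → ℝ),
      -- the algorithm for `IBDD(RS[q, k]_q, τ' q)` runs in time `poly(q) / P`,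
      (∃ p : Polynomial ℕ, ∀ i, ((E i).size : ℝ) ≤ ((p.eval (q i) : ℕ) : ℝ) / P i) ∧
      -- so it is efficient when `P` is at least inverse polynomial,
      (InversePolyBounded q P → PolyBounded q fun i => (E i).size) ∧
      -- it succeeds with probability at least `P - ε`,
      (∀ i, P i - ε i ≤
        ibddSuccess (reedSolomon (α i) (k i)) (tauPrime (q i) (τ i) * q i) (E i)) ∧
      -- and `ε = negl(q)`, with an explicit rate
      (∀ i, 0 ≤ ε i ∧
        ε i ≤ 3 * Real.exp (-((tauPerp (q i) (τ i) * q i) ^ (1 / 3 : ℝ)) / 6)) ∧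
      (Tendsto (fun i => tauPerp (q i) (τ i) * q i / Real.log (q i) ^ 3)
          (comap q atTop) atTop → Negligible q ε)) ∧
    -- `τ' = τ^⊥ (1 + o(1))` whenever `τ^⊥ q → ∞`
    (∀ l : Filter ι, Tendsto (fun i => tauPerp (q i) (τ i) * q i) l atTop →
      Tendsto (fun i => tauPrime (q i) (τ i) / tauPerp (q i) (τ i)) l (𝓝 1)) := by
  refine ⟨?_, fun l hl => tendsto_tauPrime_div_tauPerp q τ l hl⟩
  choose E hEsize hE using fun i => exists_ibdd_circuit (hq i) (α i) (hk i).1 (hτ i).1 (hτ i).2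
    (hP i) (D i) (hDP i)
  obtain ⟨p, hp⟩ := hD
  let p' : Polynomial ℕ := Polynomial.C 2688 * p ^ 2 * Polynomial.X ^ 6
  have hp' (i : ι) : ((E i).size : ℝ) ≤ ((p'.eval (q i) : ℕ) : ℝ) / P i := by
    refine (hEsize i).trans (div_le_div_of_nonneg_right ?_ (hP i).le)
    have : 2688 * (D i).size ^ 2 * q i ^ 6 ≤ p'.eval (q i) := by
      simp only [p', Polynomial.eval_mul, Polynomial.eval_C, Polynomial.eval_pow, Polynomial.eval_X]
      have := hp i
      gcongr
    exact_mod_cast this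
  refine ⟨E, fun i => 3 * Real.exp (-((tauPerp (q i) (τ i) * q i) ^ (1 / 3 : ℝ)) / 6), ⟨p', hp'⟩,
    ?_, hE, fun i => ⟨by positivity, le_rfl⟩, negligible_exp q _⟩
  rintro ⟨r, hr⟩
  -- An inverse polynomial lower bound on `P` replaces the factor `1 / P` by the polynomial `r`.
  refine ⟨p' * r, fun i => ?_⟩
  have h : ((E i).size : ℝ) ≤ ((p'.eval (q i) : ℕ) : ℝ) * ((r.eval (q i) : ℕ) : ℝ) := by
    refine (hp' i).trans ?_
    rw [div_le_iff₀ (hP i), mul_assoc]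
    refine le_mul_of_one_le_right (Nat.cast_nonneg _) ?_
    rw [mul_comm]
    exact hr i
  rw [Polynomial.eval_mul]
  exact_mod_cast h
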